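/- Let $X$ be a connected (Hausdorff) CW complex that is an $H$-space, i.e. there are a continuous map $m\colon X\times X\to X$ and a point $e\in X$ with $m(e,e)=e$ such that the maps $x\mapsto m(e,x)$ and $x\mapsto m(x,e)$ are homotopic to the identity of $X$ relative to $e$. Let $x_0\in X$ be a base point and $\pi=\pi_1(X,x_0)$. Then $$\mathsf{TC}^{\mathcal D}(X)=\mathsf{cat}_1(X)$$ in $\{0,1,2,\dots\}\cup\{\infty\}$. Here: $\bullet$ The $\mathcal D$-topological complexity $\mathsf{TC}^{\mathcal D}(X)$ is the smallest integer $k\ge 0$ such that $X\times X$ can be covered by $k+1$ open subsets $U_0,\dots,U_k$ with the property that, for every $i$ and every base point $u\in U_i$, the homomorphism $\pi_1(U_i,u)\to\pi_1(X\times X,u)$ induced by the inclusion takes values in a subgroup conjugate to the diagonal $\Delta\subset\pi\times\pi=\pi_1(X\times X,(x_0,x_0))$, where $\pi_1(X\times X,u)$ is identified with $\pi\times\pi$ by means of a path from $u$ to $(x_0,x_0)$, uniquely up to conjugation; it is $\infty$ if there is no such $k$. $\bullet$ The one-category $\mathsf{cat}_1(X)$ is the sectional category of the universal cover $P\colon\widetilde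 X\to X$, i.e. the smallest integer $k\ge 0$ such that $X$ can be covered by $k+1$ open subsets $U_0,\dots,U_k$, each of which admits a continuous map $s_i\colon U_i\to\widetilde X$ with $P\circ s_i$ equal to the inclusion $U_i\hookrightarrow X$; it is $\infty$ if there is no such $k$. -/

import Mathlib

namespace DTopologicalComplexity

/-- `HasSectionalCover p k`: the base of `p` is covered by `k + 1` open sets, each of which carries
a continuous local section of `p`. -/
def HasSectionalCover {E B : Type*} [TopologicalSpace E] [TopologicalSpace B] (p : E → B)
    (k : ℕ) : Prop :=
  ∃ U : Fin (k + 1) → Set B, (∀ i, IsOpen (U i)) ∧ (⋃ i, U i) = Set.univ ∧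
    ∀ i, ∃ s : C(U i, E), ∀ b : U i, p (s b) = b

/-- The (normalised) sectional category of `p`: the smallest `k` such that the base is covered by
`k + 1` open sets with local sections, and `⊤` if there is no such `k`. -/
noncomputable def secat {E B : Type*} [TopologicalSpace E] [TopologicalSpace B] (p : E → B) : ℕ∞ :=
  ⨅ (k : ℕ) (_ : HasSectionalCover p k), (k : ℕ∞)

/-- The universal cover of `X`, built on homotopy classes (relative to the endpoints) of paths
starting at `x₀`; a point is an endpoint `x` together with such a class from `x₀` to `x`. -/
structure UniversalCover {X : Type*} [TopologicalSpace X] (x₀ : X) where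
  /-- The endpoint. -/
  pt : X
  /-- The homotopy class of paths from `x₀` to the endpoint. -/
  cls : Path.Homotopic.Quotient x₀ pt

namespace UniversalCover

variable {X : Type*} [TopologicalSpace X] {x₀ : X}

/-- The set of all classes `[γ · η]`, where `a = [γ]` and `η` is a path in `U` that starts at the
endpoint of `γ`. -/
def basicOpen (a : UniversalCover x₀) (U : Set X) : Set (UniversalCover x₀) :=
  {b | ∃ η : Path a.pt b.pt, (∀ t, η t ∈ U) ∧
    b.cls = a.cls.trans (Path.Homotopic.Quotient.mk η)}

/-- The usual topology on the universal cover: the sets `basicOpen a U`, for `U` an open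
neighbourhood of the endpoint of `a`, form a basis. -/
instance instTopologicalSpace : TopologicalSpace (UniversalCover x₀) :=
  TopologicalSpace.generateFrom
    {S | ∃ (a : UniversalCover x₀) (U : Set X), IsOpen U ∧ a.pt ∈ U ∧ S = basicOpen a U}

/-- The covering projection: a class of paths is sent to its endpoint. -/
def proj (x₀ : X) : UniversalCover x₀ → X := UniversalCover.pt

end UniversalCover

/-- The one-category of `X`: the sectional category of the universal cover of `X`. -/
noncomputable def catOne {X : Type*} [TopologicalSpace X] (x₀ : X) : ℕ∞ :=
  secat (UniversalCover.proj x₀)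

/-- The diagonal subgroup `Δ` of `π₁(X × X, (x₀, x₀)) = π × π`, where `π = π₁(X, x₀)`: the elements
whose two components, the images under the two projections, agree. -/
noncomputable def diagonalSubgroup {X : Type*} [TopologicalSpace X] (x₀ : X) :
    Subgroup (FundamentalGroup (X × X) (x₀, x₀)) :=
  MonoidHom.eqLocus (FundamentalGroup.map (ContinuousMap.fst : C(X × X, X)) (x₀, x₀))
    (FundamentalGroup.map (ContinuousMap.snd : C(X × X, X)) (x₀, x₀))

/-- The image of `π₁(U, u) → π₁(Y, u)`, induced by the inclusion of `U` in `Y`. -/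
noncomputable def inclusionRange {Y : Type*} [TopologicalSpace Y] (U : Set Y) (u : U) :
    Subgroup (FundamentalGroup Y (u : Y)) :=
  (FundamentalGroup.map (⟨Subtype.val, continuous_subtype_val⟩ : C(U, Y)) u).range

/-- For every base point `u` of `U`, the homomorphism `π₁(U, u) → π₁(X × X, u)` takes values in a
subgroup conjugate to the diagonal. A path from `u` to `(x₀, x₀)` identifies `π₁(X × X, u)` with
`π₁(X × X, (x₀, x₀)) = π × π`; different paths give all identifications, and these differ by
conjugations, so that the subgroups conjugate to the diagonal are the preimages of `Δ` under the
various identifications. -/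
def IsDiagonalSet {X : Type*} [TopologicalSpace X] (x₀ : X) (U : Set (X × X)) : Prop :=
  ∀ u : U, ∃ γ : Path (u : X × X) (x₀, x₀),
    inclusionRange U u ≤ (diagonalSubgroup x₀).comap
      (FundamentalGroup.fundamentalGroupMulEquivOfPath γ).toMonoidHom

/-- The `𝒟`-topological complexity of `X` (with base point `x₀`): the smallest `k` such that
`X × X` is covered by `k + 1` open sets `U` for which the homomorphisms `π₁(U, u) → π₁(X × X, u)`
take values in subgroups conjugate to the diagonal; it is `⊤` if there is no such `k`. -/
noncomputable def tcD {X : Type*} [TopologicalSpace X] (x₀ : X) : ℕ∞ :=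
  ⨅ (k : ℕ) (_ : ∃ U : Fin (k + 1) → Set (X × X), (∀ i, IsOpen (U i)) ∧
    (⋃ i, U i) = Set.univ ∧ ∀ i, IsDiagonalSet x₀ (U i)), (k : ℕ∞)

end DTopologicalComplexity

/-! For each `k` the two covering conditions are equivalent. Both turn on open sets whose loops are
null-homotopic in the ambient space (`LoopsTrivialIn`). On a connected CW complex these are exactly
the open sets over which the universal cover has a section (`loopsTrivialIn_of_section`,
`exists_section_of_loopsTrivialIn`).

From `X × X` to `X`: restrict a diagonal set to the slice `X × {x₀}`. A loop there has classes `(p,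
1)`, and conjugacy into the diagonal forces `p = 1` (`IsDiagonalSet.loopsTrivialIn_slice`).

From `X` to `X × X`: pull the cover back along a difference map `d (x, y) = j x · y`, with `j` a
left homotopy inverse (`exists_difference`). If `d` kills `(a, b) = (a, a) (1, a⁻¹b)`, then it kills
`(1, a⁻¹b)`, since `d` is null-homotopic on the diagonal; as `d (x₀, -)` is homotopic to the
identity, `a = b` (`eq_of_map_prod_eq_refl`).

The topological work is by cellular induction, in the form of `exists_continuous_selection`. For
`j`, one selects points in the homotopy fibres over `e` of the right translations `y ↦ y · x`; these
translations are homotopic to the identity, so the fibres are contractible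
(`exists_fibre_contraction`). Selecting paths to a given point instead yields its contractible
neighbourhoods (`exists_isOpen_contraction`), which the study of sections needs. -/

namespace DTopologicalComplexity

/-! ### Cellular induction and local path-connectedness of CW complexes -/

section CWSections

open Topology Metric Set

variable {X : Type*} [TopologicalSpace X] [T2Space X] [CWComplex (univ : Set X)]
  {E : Type*} [TopologicalSpace E]

/-- A map on a skeleton is continuous if its composites with the characteristic maps are. -/
theorem continuousOn_skeletonLT {s : X → E} {n : ℕ∞}
    (h : ∀ m : ℕ, m < n → ∀ i : RelCWComplex.cell (univ : Set X) m,
      ContinuousOn (fun z => s (RelCWComplex.map m i z)) (closedBall 0 1)) :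
    ContinuousOn s (RelCWComplex.skeletonLT (univ : Set X) n) := by
  rw [continuousOn_iff_isClosed]
  intro t ht
  refine ⟨s ⁻¹' t ∩ RelCWComplex.skeletonLT (univ : Set X) n, ?_, by
    rw [inter_assoc, inter_self]⟩
  refine CWComplex.isClosed_of_disjoint_openCell_or_isClosed_inter_closedCell
    (C := (univ : Set X)) (subset_univ _) fun m _ i => ?_
  by_cases hm : (m : ℕ∞) < n
  · right
    have hsub : RelCWComplex.closedCell m i ⊆ RelCWComplex.skeletonLT (univ : Set X) n :=
      (RelCWComplex.closedCell_subset_skeletonLT m i).trans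
        (RelCWComplex.skeletonLT_mono (Order.add_one_le_of_lt hm))
    have : s ⁻¹' t ∩ RelCWComplex.skeletonLT (univ : Set X) n ∩ RelCWComplex.closedCell m i =
        RelCWComplex.map m i '' (closedBall 0 1 ∩
          (fun z => s (RelCWComplex.map m i z)) ⁻¹' t) := by
      ext x
      constructor
      · rintro ⟨⟨hx, -⟩, z, hz, rfl⟩
        exact ⟨z, ⟨hz, hx⟩, rfl⟩
      · rintro ⟨z, ⟨hz, hx⟩, rfl⟩
        exact ⟨⟨hx, hsub ⟨z, hz, rfl⟩⟩, z, hz, rfl⟩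
    rw [this]
    refine IsCompact.isClosed (IsCompact.image_of_continuousOn ?_
      ((RelCWComplex.continuousOn m i).mono inter_subset_left))
    exact (isCompact_closedBall (0 : Fin m → ℝ) 1).of_isClosed_subset
      ((h m hm i).preimage_isClosed_of_isClosed isClosed_closedBall ht) inter_subset_left
  · left
    exact (RelCWComplex.disjoint_skeletonLT_openCell (not_lt.1 hm)).mono_left inter_subset_right

/-- A partial section of `p` over the union of the cells of dimension less than `n`. -/
def IsSkeletalSection (p : E → X) (n : ℕ) (s : X → E) : Prop :=
  (∀ m : ℕ, m < n → ∀ i : RelCWComplex.cell (univ : Set X) m,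
      ContinuousOn (fun z => s (RelCWComplex.map m i z)) (closedBall 0 1)) ∧
    ∀ x ∈ (RelCWComplex.skeletonLT (univ : Set X) n : Set X), p (s x) = x

/-- The property that lifts over the boundary of a cell extend over the cell. -/
def CellularExtension (p : E → X) : Prop :=
  ∀ (n : ℕ) (i : RelCWComplex.cell (univ : Set X) n) (σ : (Fin n → ℝ) → E),
    ContinuousOn σ (sphere 0 1) → (∀ z ∈ sphere 0 1, p (σ z) = RelCWComplex.map n i z) →
    ∃ τ : (Fin n → ℝ) → E, ContinuousOn τ (closedBall 0 1) ∧ EqOn τ σ (sphere 0 1) ∧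
      ∀ z ∈ closedBall 0 1, p (τ z) = RelCWComplex.map n i z

/-- The open `n`-cells are disjoint from one another and from the lower skeleton, so the extensions
over individual cells can be chosen independently. -/
theorem IsSkeletalSection.exists_succ {p : E → X} (hp : CellularExtension p) {n : ℕ} {s : X → E}
    (hs : IsSkeletalSection p n s) :
    ∃ s' : X → E, IsSkeletalSection p (n + 1) s' ∧
      EqOn s' s (RelCWComplex.skeletonLT (univ : Set X) n) := by
  classical
  have hfr : ∀ (i : RelCWComplex.cell (univ : Set X) n), ∀ z ∈ sphere (0 : Fin n → ℝ) 1,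
      RelCWComplex.map n i z ∈ (RelCWComplex.skeletonLT (univ : Set X) n : Set X) := fun i z hz =>
    RelCWComplex.cellFrontier_subset_skeletonLT n i ⟨z, hz, rfl⟩
  have hsc : ContinuousOn s (RelCWComplex.skeletonLT (univ : Set X) n) :=
    continuousOn_skeletonLT fun m hm i => hs.1 m (by exact_mod_cast hm) i
  choose τ hτc hτs hτp using fun i : RelCWComplex.cell (univ : Set X) n =>
    hp n i (fun z => s (RelCWComplex.map n i z))
      (hsc.comp ((RelCWComplex.continuousOn n i).mono sphere_subset_closedBall) (hfr i))
      (fun z hz => hs.2 _ (hfr i z hz))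
  let s' : X → E := fun x =>
    if x ∈ (RelCWComplex.skeletonLT (univ : Set X) n : Set X) then s x
    else if h : ∃ i : RelCWComplex.cell (univ : Set X) n, x ∈ RelCWComplex.openCell n i then
      τ h.choose ((RelCWComplex.map n h.choose).symm x) else s x
  have hs's : EqOn s' s (RelCWComplex.skeletonLT (univ : Set X) n) := fun x hx => if_pos hx
  have hs'τ : ∀ i : RelCWComplex.cell (univ : Set X) n, ∀ z ∈ closedBall (0 : Fin n → ℝ) 1,
      s' (RelCWComplex.map n i z) = τ i z := by
    intro i z hz
    by_cases hz1 : z ∈ sphere (0 : Fin n → ℝ) 1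
    · rw [hs's (hfr i z hz1), hτs i hz1]
    · have hzb : z ∈ ball (0 : Fin n → ℝ) 1 := by
        rw [mem_ball]; exact lt_of_le_of_ne hz hz1
      have hmem : RelCWComplex.map n i z ∈ RelCWComplex.openCell n i := ⟨z, hzb, rfl⟩
      have hnot : RelCWComplex.map n i z ∉
          (RelCWComplex.skeletonLT (univ : Set X) n : Set X) := fun h =>
        disjoint_left.1 (RelCWComplex.disjoint_skeletonLT_openCell le_rfl) h hmem
      have hex : ∃ j : RelCWComplex.cell (univ : Set X) n,
          RelCWComplex.map n i z ∈ RelCWComplex.openCell n j := ⟨i, hmem⟩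
      have hij : hex.choose = i := by
        have := RelCWComplex.eq_of_not_disjoint_openCell
          (not_disjoint_iff.2 ⟨_, hex.choose_spec, hmem⟩)
        simpa using this
      have h1 : s' (RelCWComplex.map n i z) =
          τ hex.choose ((RelCWComplex.map n hex.choose).symm (RelCWComplex.map n i z)) := by
        simp only [s']
        rw [if_neg hnot, dif_pos hex]
      rw [h1, hij, (RelCWComplex.map n i).left_inv]
      rwa [RelCWComplex.source_eq]
  refine ⟨s', ⟨fun m hm i => ?_, fun x hx => ?_⟩, hs's⟩
  · rcases Nat.lt_succ_iff_lt_or_eq.1 hm with hm | rfl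
    · refine (hs.1 m hm i).congr fun z hz => hs's ?_
      refine RelCWComplex.skeletonLT_mono ?_
        (RelCWComplex.closedCell_subset_skeletonLT m i ⟨z, hz, rfl⟩)
      exact_mod_cast hm
    · exact (hτc i).congr (hs'τ i)
  · have hx' : x ∈ (RelCWComplex.skeletonLT (univ : Set X) ((n : ℕ∞) + 1) : Set X) := by
      exact_mod_cast hx
    rw [← RelCWComplex.skeletonLT_union_iUnion_closedCell_eq_skeletonLT_succ] at hx'
    rcases hx' with hx' | hx'
    · rw [hs's hx', hs.2 x hx']
    · obtain ⟨i, z, hz, rfl⟩ := mem_iUnion.1 hx'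
      rw [hs'τ i z hz, hτp i z hz]

/-- If lifts over the boundaries of cells extend over the cells, then there is a section. -/
theorem CellularExtension.exists_section [Nonempty E] {p : E → X} (hp : CellularExtension p) :
    ∃ s : X → E, Continuous s ∧ ∀ x, p (s x) = x := by
  classical
  choose! next hnext1 hnext2 using fun (n : ℕ) (s : X → E) (hs : IsSkeletalSection p n s) =>
    hs.exists_succ hp
  obtain ⟨e₀⟩ := ‹Nonempty E›
  let s : ℕ → X → E := fun n => Nat.rec (fun _ => e₀) next n
  have hs : ∀ n, IsSkeletalSection p n (s n) := by
    intro n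
    induction n with
    | zero =>
      refine ⟨fun m hm => absurd hm (Nat.not_lt_zero m), fun x hx => ?_⟩
      have : (RelCWComplex.skeletonLT (univ : Set X) ((0 : ℕ) : ℕ∞) : Set X) = ∅ := by
        simpa using CWComplex.skeletonLT_zero_eq_empty (C := (univ : Set X))
      rw [this] at hx
      exact hx.elim
    | succ n ih => exact hnext1 n _ ih
  have hmono : ∀ n k, EqOn (s (n + k)) (s n) (RelCWComplex.skeletonLT (univ : Set X) n) := by
    intro n k
    induction k with
    | zero => exact fun _ _ => rfl
    | succ k ih =>
      intro x hx
      rw [← ih hx]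
      refine hnext2 (n + k) _ (hs _) (RelCWComplex.skeletonLT_mono ?_ hx)
      exact_mod_cast Nat.le_add_right n k
  have hex : ∀ x : X, ∃ n : ℕ, x ∈ (RelCWComplex.skeletonLT (univ : Set X) n : Set X) := by
    intro x
    have : x ∈ ⋃ n : ℕ, (RelCWComplex.skeletonLT (univ : Set X) n : Set X) := by
      rw [RelCWComplex.iUnion_skeletonLT_eq_complex]; trivial
    exact mem_iUnion.1 this
  choose N hN using hex
  -- The partial sections agree on lower skeleta, so the choice of `N x` does not affect the value.
  let S : X → E := fun x => s (N x) x
  have hS : ∀ n : ℕ, EqOn S (s n) (RelCWComplex.skeletonLT (univ : Set X) n) := by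
    intro n x hx
    rcases le_total n (N x) with h | h
    · obtain ⟨k, hk⟩ := Nat.exists_eq_add_of_le h
      change s (N x) x = _
      rw [hk]
      exact hmono n k hx
    · obtain ⟨k, rfl⟩ := Nat.exists_eq_add_of_le h
      exact (hmono (N x) k (hN x)).symm
  refine ⟨S, ?_, fun x => (hs _).2 x (hN x)⟩
  have hcont : ContinuousOn S (RelCWComplex.skeletonLT (univ : Set X) ⊤) := by
    refine continuousOn_skeletonLT fun m _ i => ?_
    refine ((hs (m + 1)).1 m (Nat.lt_succ_self m) i).congr fun z hz => hS (m + 1) ?_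
    have := RelCWComplex.closedCell_subset_skeletonLT m i ⟨z, hz, rfl⟩
    exact_mod_cast this
  rw [RelCWComplex.skeletonLT_top] at hcont
  exact continuousOn_univ.1 hcont

/-- CW complexes are locally path-connected. -/
theorem locallyPathConnectedSpace_of_CWComplex : LocallyPathConnectedSpace X := by
  let f : (Σ a : (Σ n : ℕ, RelCWComplex.cell (univ : Set X) n),
      closedBall (0 : Fin a.1 → ℝ) 1) → X := fun a => RelCWComplex.map a.1.1 a.1.2 a.2.1
  have hf : Continuous f := continuous_sigma fun a =>
    (RelCWComplex.continuousOn a.1 a.2).domRestrict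
  -- The weak topology makes the complex a quotient of the disjoint union of its closed balls, and
  -- local path-connectedness passes to quotients.
  have hq : IsQuotientMap f := by
    refine isQuotientMap_iff_isClosed.2 ⟨fun x => ?_, fun t => ⟨fun ht => ht.preimage hf,
      fun ht => ?_⟩⟩
    · have : x ∈ ⋃ (n : ℕ) (j : RelCWComplex.cell (univ : Set X) n),
          RelCWComplex.closedCell n j := by rw [CWComplex.union]; trivial
      simp only [mem_iUnion] at this
      obtain ⟨n, i, z, hz, rfl⟩ := this
      exact ⟨⟨⟨n, i⟩, ⟨z, hz⟩⟩, rfl⟩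
    · rw [CWComplex.closed (univ : Set X) t (subset_univ _)]
      intro n i
      have h1 : IsClosed ((fun z : closedBall (0 : Fin n → ℝ) 1 => f ⟨⟨n, i⟩, z⟩) ⁻¹' t) :=
        (isClosed_sigma_iff.1 ht) ⟨n, i⟩
      have h2 : t ∩ RelCWComplex.closedCell n i =
          (fun z : closedBall (0 : Fin n → ℝ) 1 => f ⟨⟨n, i⟩, z⟩) ''
            ((fun z : closedBall (0 : Fin n → ℝ) 1 => f ⟨⟨n, i⟩, z⟩) ⁻¹' t) := by
        ext x
        constructor
        · rintro ⟨hx, z, hz, rfl⟩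
          exact ⟨⟨z, hz⟩, hx, rfl⟩
        · rintro ⟨z, hz, rfl⟩
          exact ⟨hz, z.1, z.2, rfl⟩
      rw [h2]
      have : CompactSpace (closedBall (0 : Fin n → ℝ) 1) :=
        isCompact_iff_compactSpace.1 (isCompact_closedBall _ _)
      exact (h1.isCompact.image (hf.comp continuous_sigmaMk)).isClosed
  have : ∀ a : (Σ n : ℕ, RelCWComplex.cell (univ : Set X) n),
      LocallyPathConnectedSpace (closedBall (0 : Fin a.1 → ℝ) 1) := fun a =>
    (convex_closedBall (0 : Fin a.1 → ℝ) 1).locallyPathConnectedSpace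
  exact hq.locallyPathConnectedSpace

end CWSections

/-! ### Polar coordinates on balls -/

section Cone

open Topology Metric Set unitInterval

/-- A continuous map on `S × [0, 1]` that is constant on `S × {0}`, for `S` a unit sphere, induces
a continuous map in polar coordinates. -/
theorem exists_continuous_polar {V Z : Type*} [NormedAddCommGroup V] [NormedSpace ℝ V]
    [ProperSpace V] [TopologicalSpace Z] (g : sphere (0 : V) 1 × I → Z) (hg : Continuous g)
    (c : Z) (hc : ∀ z, g (z, 0) = c) :
    ∃ G : V → Z, Continuous G ∧ G 0 = c ∧
      ∀ (z : sphere (0 : V) 1) (r : I), G ((r : ℝ) • (z : V)) = g (z, r) := by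
  classical
  have hsph : ∀ w : V, w ≠ 0 → ‖w‖⁻¹ • w ∈ sphere (0 : V) 1 := fun w hw => by
    rw [mem_sphere_zero_iff_norm, norm_smul, norm_inv, norm_norm,
      inv_mul_cancel₀ (norm_ne_zero_iff.2 hw)]
  let G : V → Z := fun w => if hw : w ≠ 0 then
    g (⟨‖w‖⁻¹ • w, hsph w hw⟩, projIcc 0 1 zero_le_one ‖w‖) else c
  have hG0 : G 0 = c := dif_neg (by simp)
  refine ⟨G, ?_, hG0, fun z r => ?_⟩
  · rw [continuous_iff_continuousAt]
    intro w
    by_cases hw : w = 0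
    · subst hw
      rw [ContinuousAt, hG0]
      intro O hO
      have : CompactSpace (sphere (0 : V) 1) := isCompact_iff_compactSpace.1 (isCompact_sphere _ _)
      -- Compactness of the sphere makes the convergence to `c` uniform in the direction `z`, which
      -- gives continuity at the centre.
      have h1 : ∀ᶠ r in 𝓝 (0 : I), ∀ z ∈ (univ : Set (sphere (0 : V) 1)), g (z, r) ∈ O := by
        refine isCompact_univ.eventually_forall_of_forall_eventually fun z _ => ?_
        have h2 : Filter.Tendsto (fun q : I × sphere (0 : V) 1 => g (q.2, q.1)) (𝓝 (0, z))
            (𝓝 c) := by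
          have h := (hg.comp (continuous_swap (X := I) (Y := sphere (0 : V) 1))).tendsto (0, z)
          rwa [Function.comp_apply, Prod.swap_prod_mk, hc] at h
        exact h2.eventually hO
      have h3 : Filter.Tendsto (fun w : V => projIcc (0 : ℝ) 1 zero_le_one ‖w‖) (𝓝 0)
          (𝓝 (0 : I)) := by
        have := (continuous_projIcc (h := zero_le_one (α := ℝ)).comp
          (continuous_norm (E := V))).tendsto 0
        simpa [Function.comp_def] using this
      rw [Filter.mem_map]
      filter_upwards [h3.eventually h1] with w hw
      by_cases hw0 : w = 0
      · subst hw0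
        change G 0 ∈ O
        rw [hG0]; exact mem_of_mem_nhds hO
      · change G w ∈ O
        simp only [G, dif_pos hw0]
        exact hw _ (mem_univ _)
    · have hopen : IsOpen {w : V | w ≠ 0} := isOpen_ne
      refine ContinuousOn.continuousAt (s := {w : V | w ≠ 0}) ?_ (hopen.mem_nhds hw)
      rw [continuousOn_iff_continuous_domRestrict]
      have h4 : domRestrict {w : V | w ≠ 0} G = fun w : {w : V | w ≠ 0} =>
          g (⟨‖(w : V)‖⁻¹ • (w : V), hsph w w.2⟩, projIcc 0 1 zero_le_one ‖(w : V)‖) := by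
        ext w
        exact dif_pos w.2
      rw [h4]
      refine hg.comp (Continuous.prodMk (Continuous.subtype_mk ?_ _) ?_)
      · exact ((continuous_norm.comp continuous_subtype_val).inv₀
          fun w => norm_ne_zero_iff.2 w.2).smul continuous_subtype_val
      · exact continuous_projIcc.comp (continuous_norm.comp continuous_subtype_val)
  · have hz : ‖(z : V)‖ = 1 := mem_sphere_zero_iff_norm.1 z.2
    by_cases hr : (r : ℝ) = 0
    · have : r = 0 := Subtype.ext hr
      rw [hr, zero_smul, hG0, this, hc]
    · have hz0 : (z : V) ≠ 0 := fun h => by rw [h, norm_zero] at hz; exact zero_ne_one hz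
      have hw : (r : ℝ) • (z : V) ≠ 0 := smul_ne_zero hr hz0
      have hn : ‖(r : ℝ) • (z : V)‖ = r := by
        rw [norm_smul, hz, mul_one, Real.norm_of_nonneg r.2.1]
      simp only [G, dif_pos hw]
      congr 2
      · ext1
        simp only [hn, smul_smul, inv_mul_cancel₀ hr, one_smul]
      · rw [hn, projIcc_of_mem _ r.2]

/-- Every point of the closed unit ball other than the centre has polar coordinates. -/
theorem exists_polar {V : Type*} [NormedAddCommGroup V] [NormedSpace ℝ V] {w : V}
    (hw : w ∈ closedBall (0 : V) 1) (h0 : w ≠ 0) :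
    ∃ (z : sphere (0 : V) 1) (r : I), w = (r : ℝ) • (z : V) := by
  have hn := norm_ne_zero_iff.2 h0
  refine ⟨⟨‖w‖⁻¹ • w, ?_⟩, ⟨‖w‖, norm_nonneg w, mem_closedBall_zero_iff.1 hw⟩, ?_⟩
  · rw [mem_sphere_zero_iff_norm, norm_smul, norm_inv, norm_norm, inv_mul_cancel₀ hn]
  · simp [smul_smul, mul_inv_cancel₀ hn]

/-- Extending a map from the unit sphere to the closed unit ball by polar coordinates. -/
theorem exists_ball_extension {V Y : Type*} [NormedAddCommGroup V] [NormedSpace ℝ V]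
    [ProperSpace V] [TopologicalSpace Y] {R : V → Y → Prop} {φ : sphere (0 : V) 1 → Y}
    {g : sphere (0 : V) 1 × I → Y} (hg : Continuous g) (h1 : ∀ z, g (z, 1) = φ z) {c : Y}
    (h0 : ∀ z, g (z, 0) = c) (hRφ : ∀ z : sphere (0 : V) 1, R z (φ z)) (hRc : R 0 c)
    (hRg : ∀ (z : sphere (0 : V) 1) (r : I), r < 1 → R ((r : ℝ) • (z : V)) (g (z, r))) :
    ∃ ψ : C(closedBall (0 : V) 1, Y),
      (∀ z : sphere (0 : V) 1, ψ ⟨z, sphere_subset_closedBall z.2⟩ = φ z) ∧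
      ∀ w : closedBall (0 : V) 1, R w (ψ w) := by
  obtain ⟨G, hG, hG0, hGg⟩ := exists_continuous_polar g hg c h0
  have hGφ : ∀ z : sphere (0 : V) 1, G z = φ z := fun z => by
    have := hGg z 1
    rwa [Icc.coe_one, one_smul, h1] at this
  refine ⟨⟨fun w => G w, hG.comp continuous_subtype_val⟩, hGφ, fun w => ?_⟩
  change R w (G w)
  by_cases hw : (w : V) = 0
  · rw [hw, hG0]; exact hRc
  · obtain ⟨z, r, hzr⟩ := exists_polar w.2 hw
    rcases eq_or_lt_of_le (show r ≤ 1 from r.2.2) with rfl | hr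
    · rw [Icc.coe_one, one_smul] at hzr
      rw [hzr, hGφ]; exact hRφ z
    · rw [hzr, hGg]; exact hRg z r hr

end Cone

/-! ### Concatenation of families of paths -/

section Glue

open Topology Set unitInterval

variable {P X : Type*}

/-- The concatenation of two families of paths, parametrised by `[0, 2]`. -/
noncomputable def glue (a b : P → I → X) (p : P) (q : ℝ) : X :=
  if q ≤ 1 then a p (projIcc 0 1 zero_le_one q) else b p (projIcc 0 1 zero_le_one (q - 1))

theorem continuous_glue [TopologicalSpace P] [TopologicalSpace X] {a b : P → I → X} (ha : Continuous (Function.uncurry a))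
    (hb : Continuous (Function.uncurry b)) (h : ∀ p, a p 1 = b p 0) :
    Continuous (fun x : P × ℝ => glue a b x.1 x.2) := by
  refine Continuous.if_le ?_ ?_ continuous_snd continuous_const fun x hx => ?_
  · exact ha.comp (continuous_fst.prodMk ((continuous_projIcc (h := zero_le_one (α := ℝ))).comp continuous_snd))
  · exact hb.comp (continuous_fst.prodMk ((continuous_projIcc (h := zero_le_one (α := ℝ))).comp
      (continuous_snd.sub continuous_const)))
  · rw [hx, projIcc_right, sub_self, projIcc_left]
    exact h x.1

theorem glue_left (a b : P → I → X) (p : P) (r : I) : glue a b p r = a p r := by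
  rw [glue, if_pos r.2.2, projIcc_of_mem _ r.2]

theorem glue_right {a b : P → I → X} (h : ∀ p, a p 1 = b p 0) (p : P) (r : I) :
    glue a b p (1 + r) = b p r := by
  by_cases hr : (1 + r : ℝ) ≤ 1
  · have : r = 0 := Subtype.ext (le_antisymm (by simpa using hr) r.2.1)
    subst this
    rw [← h, Icc.coe_zero, add_zero, ← Icc.coe_one, glue_left]
  · rw [glue, if_neg hr, add_sub_cancel_left, projIcc_of_mem _ r.2]

theorem glue_zero (a b : P → I → X) (p : P) : glue a b p 0 = a p 0 := by
  simpa using glue_left a b p 0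

theorem glue_two {a b : P → I → X} (h : ∀ p, a p 1 = b p 0) (p : P) :
    glue a b p 2 = b p 1 := by
  have := glue_right h p 1
  rwa [Icc.coe_one, one_add_one_eq_two] at this

end Glue

/-! ### Continuous selections on CW complexes -/

section CellularSelection

open Topology Metric Set

/-- A continuous selection on a CW complex exists if selections over the boundaries of cells
extend over the cells. -/
theorem exists_continuous_selection {X Y : Type*} [TopologicalSpace X] [T2Space X]
    [CWComplex (univ : Set X)] [TopologicalSpace Y] (P : X → Y → Prop) (hne : ∃ x y, P x y)
    (H : ∀ (n : ℕ) (i : RelCWComplex.cell (univ : Set X) n)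
      (σ : C(sphere (0 : Fin n → ℝ) 1, Y)), (∀ z : sphere (0 : Fin n → ℝ) 1, P (RelCWComplex.map n i z) (σ z)) →
      ∃ τ : C(closedBall (0 : Fin n → ℝ) 1, Y),
        (∀ z : sphere (0 : Fin n → ℝ) 1, τ ⟨z, sphere_subset_closedBall z.2⟩ = σ z) ∧
        ∀ w : closedBall (0 : Fin n → ℝ) 1, P (RelCWComplex.map n i w) (τ w)) :
    ∃ s : C(X, Y), ∀ x, P x (s x) := by
  classical
  obtain ⟨x₀, y₀, h₀⟩ := hne
  -- A selection is a section of the first projection of the graph of `P`.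
  let E := {a : X × Y // P a.1 a.2}
  have : Nonempty E := ⟨⟨(x₀, y₀), h₀⟩⟩
  have hp : CellularExtension (fun a : E => a.1.1) := by
    intro n i σ hσ hσp
    obtain ⟨τ, hτ, hτP⟩ := H n i ⟨fun z => (σ z).1.2, (continuous_snd.comp
      continuous_subtype_val).comp (continuousOn_iff_continuous_domRestrict.1 hσ)⟩
      (fun z => by have := (σ z).2; rwa [show (σ z).1.1 = _ from hσp z z.2] at this)
    refine ⟨fun z => if hz : z ∈ closedBall (0 : Fin n → ℝ) 1 then
      ⟨(RelCWComplex.map n i z, τ ⟨z, hz⟩), hτP ⟨z, hz⟩⟩ else ⟨(x₀, y₀), h₀⟩, ?_, ?_, ?_⟩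
    · rw [continuousOn_iff_continuous_domRestrict]
      have h1 : Continuous fun z : closedBall (0 : Fin n → ℝ) 1 =>
          (⟨(RelCWComplex.map n i z, τ z), hτP z⟩ : E) :=
        ((continuousOn_iff_continuous_domRestrict.1
          (RelCWComplex.continuousOn n i)).prodMk τ.continuous).subtype_mk _
      convert h1 using 1
      ext z : 1
      exact dif_pos z.2
    · intro z hz
      have hz' := sphere_subset_closedBall hz
      simp only [dif_pos hz']
      refine Subtype.ext (Prod.ext ?_ ?_)
      · exact (hσp z hz).symm
      · exact hτ ⟨z, hz⟩
    · intro z hz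
      simp only [dif_pos hz]
  obtain ⟨s, hs, hsp⟩ := hp.exists_section
  refine ⟨⟨fun x => (s x).1.2, continuous_snd.comp (continuous_subtype_val.comp hs)⟩, fun x => ?_⟩
  have := (s x).2
  rwa [hsp x] at this

end CellularSelection

/-! ### Contractible neighbourhoods of points -/

section LocalContraction

open Topology Metric Set unitInterval

/-- The radial map `S × [0, 1] → X` of a map on the closed unit ball. -/
noncomputable def radial {V X : Type*} [NormedAddCommGroup V] [NormedSpace ℝ V]
    (Q : V → X) (z : sphere (0 : V) 1) (r : I) : X := Q ((r : ℝ) • (z : V))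

theorem smul_mem_closedBall {V : Type*} [NormedAddCommGroup V] [NormedSpace ℝ V]
    (z : sphere (0 : V) 1) (r : I) : (r : ℝ) • (z : V) ∈ closedBall (0 : V) 1 := by
  rw [mem_closedBall_zero_iff, norm_smul, mem_sphere_zero_iff_norm.1 z.2, mul_one,
    Real.norm_of_nonneg r.2.1]
  exact r.2.2

theorem smul_mem_ball {V : Type*} [NormedAddCommGroup V] [NormedSpace ℝ V]
    (z : sphere (0 : V) 1) {r : I} (hr : r < 1) : (r : ℝ) • (z : V) ∈ ball (0 : V) 1 := by
  rw [mem_ball_zero_iff, norm_smul, mem_sphere_zero_iff_norm.1 z.2, mul_one,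
    Real.norm_of_nonneg r.2.1]
  exact hr

theorem continuous_radial {V X : Type*} [NormedAddCommGroup V] [NormedSpace ℝ V]
    [TopologicalSpace X] {Q : V → X} (hQ : ContinuousOn Q (closedBall 0 1)) :
    Continuous (Function.uncurry (radial Q)) := by
  refine hQ.comp_continuous (f := fun x : sphere (0 : V) 1 × I => (x.2 : ℝ) • (x.1 : V))
    (by fun_prop) fun x => smul_mem_closedBall x.1 x.2

variable {X : Type*} [TopologicalSpace X]

/-- The relation between points `y` and pairs `(t, γ)` which says that `γ` is a path starting at
`y`, that it ends at `x` if `t > 0`, that `t > 0` for `y = x`, and that `t = 0` and `γ` is constant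
for `y` in `A`. -/
def IsPartialContraction (A : Set X) (x y : X) (a : ℝ × C(I, X)) : Prop :=
  a.2 0 = y ∧ (0 < a.1 → a.2 1 = x) ∧ (y ∈ A → a.1 = 0 ∧ ∀ u, a.2 u = y) ∧ (y = x → 0 < a.1)

/-- Over an open cell that misses both `A` and `x`, only the endpoint conditions remain. Near the
boundary, a point moves radially outwards and then follows the path given there; towards the centre
the weight `t` is cut off to zero, so the path need no longer reach `x`. -/
theorem exists_extension_of_notMem {V : Type*} [NormedAddCommGroup V] [NormedSpace ℝ V]
    [ProperSpace V] {Q : V → X} (hQ : ContinuousOn Q (closedBall 0 1)) {A : Set X} {x : X}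
    (hA : ∀ w ∈ ball (0 : V) 1, Q w ∉ A ∧ Q w ≠ x) (φ : C(sphere (0 : V) 1, ℝ × C(I, X)))
    (hφ : ∀ z : sphere (0 : V) 1, IsPartialContraction A x (Q z) (φ z)) :
    ∃ ψ : C(closedBall (0 : V) 1, ℝ × C(I, X)),
      (∀ z : sphere (0 : V) 1, ψ ⟨z, sphere_subset_closedBall z.2⟩ = φ z) ∧
      ∀ w : closedBall (0 : V) 1, IsPartialContraction A x (Q w) (ψ w) := by
  let b : sphere (0 : V) 1 → I → X := fun z u => (φ z).2 u
  have hb : Continuous (Function.uncurry b) := by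
    have : Continuous fun z : sphere (0 : V) 1 => (φ z).2 := continuous_snd.comp φ.continuous
    exact (this.comp continuous_fst).eval continuous_snd
  have hab : ∀ z, radial Q z 1 = b z 0 := fun z => by
    simp only [radial, Icc.coe_one, one_smul, b, (hφ z).1]
  have hΘ := continuous_glue (continuous_radial hQ) hb hab
  -- The path runs along the concatenation from parameter `r` to `min (4r) 2`. It is constant for `r
  -- = 0`, is the given path for `r = 1`, and reaches the end for all `r ≥ 1/2`, which covers the
  -- region where the weight `max 0 (2r - 1)` is positive.
  let F : C((sphere (0 : V) 1 × I) × I, X) := ⟨fun p => glue (radial Q) b p.1.1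
    ((1 - (p.2 : ℝ)) * (p.1.2 : ℝ) + (p.2 : ℝ) * min (4 * (p.1.2 : ℝ)) 2), by
      exact hΘ.comp (f := fun p : (sphere (0 : V) 1 × I) × I =>
        (p.1.1, (1 - (p.2 : ℝ)) * (p.1.2 : ℝ) + (p.2 : ℝ) * min (4 * (p.1.2 : ℝ)) 2)) (by fun_prop)⟩
  let g : sphere (0 : V) 1 × I → ℝ × C(I, X) := fun p =>
    (max 0 (2 * (p.2 : ℝ) - 1) * (φ p.1).1, F.curry p)
  have hg : Continuous g := by
    have : Continuous fun z : sphere (0 : V) 1 => (φ z).1 := continuous_fst.comp φ.continuous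
    exact Continuous.prodMk (by fun_prop) F.curry.continuous
  refine exists_ball_extension (R := fun w => IsPartialContraction A x (Q w)) hg
    (fun z => ?_) (c := (0, ContinuousMap.const I (Q 0)))
    (fun z => ?_) hφ ?_ fun z r hr => ?_
  · refine Prod.ext ?_ ?_
    · simp [g]; norm_num
    · ext u
      have h1 : (1 - (u : ℝ)) * ((1 : I) : ℝ) + (u : ℝ) * min (4 * ((1 : I) : ℝ)) 2 = 1 + u := by
        rw [Icc.coe_one, min_eq_right (by norm_num)]; ring
      change glue (radial Q) b z _ = _
      rw [h1, glue_right hab]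
  · refine Prod.ext ?_ ?_
    · simp [g]
    · ext u
      have h1 : (1 - (u : ℝ)) * ((0 : I) : ℝ) + (u : ℝ) * min (4 * ((0 : I) : ℝ)) 2 = 0 := by simp
      change glue (radial Q) b z _ = _
      rw [h1, glue_zero]
      simp [radial]
  · have h0 := hA 0 (mem_ball_self one_pos)
    exact ⟨rfl, fun h => absurd h (lt_irrefl _), fun h => absurd h h0.1, fun h => absurd h h0.2⟩
  · have h0 := hA _ (smul_mem_ball z hr)
    refine ⟨?_, fun h => ?_, fun h => absurd h h0.1, fun h => absurd h h0.2⟩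
    · change glue (radial Q) b z _ = _
      simp only [Icc.coe_zero, sub_zero, one_mul, zero_mul, add_zero]
      rw [glue_left]
      rfl
    · have hr2 : (1 : ℝ) < 2 * (r : ℝ) := by
        by_contra hcon
        have : max (0 : ℝ) (2 * (r : ℝ) - 1) = 0 := max_eq_left (by linarith)
        simp [g, this] at h
      have hφ0 : 0 < (φ z).1 := by
        have : 0 < max (0 : ℝ) (2 * (r : ℝ) - 1) := lt_max_of_lt_right (by linarith)
        exact (mul_pos_iff_of_pos_left this).1 h
      change glue (radial Q) b z _ = _
      have h1 : (1 - ((1 : I) : ℝ)) * (r : ℝ) + ((1 : I) : ℝ) * min (4 * (r : ℝ)) 2 = 2 := by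
        rw [Icc.coe_one, min_eq_right (by linarith)]; ring
      rw [h1, glue_two hab]
      exact (hφ z).2.1 hφ0

/-- On the cell containing `x = Q w₀`, points move along straight segments towards `w₀`. The factor
`l` stops the motion on the boundary, where constancy is required; `t` is positive exactly within `ρ
/ 2` of `w₀`, and there `1 - ‖w‖ ≥ ρ / 2`, so `l = 1` and the segment is traversed completely. -/
theorem exists_extension_of_mem_ball {V : Type*} [NormedAddCommGroup V] [NormedSpace ℝ V]
    {Q : V → X} (hQ : ContinuousOn Q (closedBall 0 1)) {A : Set X} {w₀ : V}
    (hw₀ : w₀ ∈ ball (0 : V) 1) (hA : ∀ w ∈ ball (0 : V) 1, Q w ∉ A)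
    (hA' : ∀ z ∈ sphere (0 : V) 1, Q z ∈ A) (hinj : InjOn Q (ball 0 1))
    (φ : C(sphere (0 : V) 1, ℝ × C(I, X)))
    (hφ : ∀ z : sphere (0 : V) 1, IsPartialContraction A (Q w₀) (Q z) (φ z)) :
    ∃ ψ : C(closedBall (0 : V) 1, ℝ × C(I, X)),
      (∀ z : sphere (0 : V) 1, ψ ⟨z, sphere_subset_closedBall z.2⟩ = φ z) ∧
      ∀ w : closedBall (0 : V) 1, IsPartialContraction A (Q w₀) (Q w) (ψ w) := by
  have hρ : 0 < 1 - ‖w₀‖ := sub_pos.2 (mem_ball_zero_iff.1 hw₀)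
  set ρ : ℝ := 1 - ‖w₀‖ with hρdef
  let l : V → ℝ := fun w => min 1 (2 * (1 - ‖w‖) / ρ)
  have hl0 : ∀ w ∈ closedBall (0 : V) 1, 0 ≤ l w := fun w hw =>
    le_min zero_le_one (div_nonneg (mul_nonneg zero_le_two
      (sub_nonneg.2 (mem_closedBall_zero_iff.1 hw))) hρ.le)
  have hl1 : ∀ w, l w ≤ 1 := fun w => min_le_left _ _
  have hlc : Continuous l := by
    have : Continuous fun w : V => 2 * (1 - ‖w‖) / ρ := by fun_prop
    exact continuous_const.min this
  have hlsph : ∀ z ∈ sphere (0 : V) 1, l z = 0 := fun z hz => by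
    simp [l, mem_sphere_zero_iff_norm.1 hz]
  let t : V → ℝ := fun w => max 0 (1 - 2 * ‖w - w₀‖ / ρ)
  have htc : Continuous t := by
    have : Continuous fun w : V => 1 - 2 * ‖w - w₀‖ / ρ := by fun_prop
    exact continuous_const.max this
  have ht : ∀ w, 0 < t w → 2 * ‖w - w₀‖ < ρ := fun w hw => by
    rcases lt_max_iff.1 hw with h | h
    · exact absurd h (lt_irrefl _)
    · rwa [sub_pos, div_lt_one hρ] at h
  have htl : ∀ w, 0 < t w → l w = 1 := fun w hw => by
    refine min_eq_left ?_
    rw [le_div_iff₀ hρ]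
    have := ht w hw
    have h2 : ‖w‖ ≤ ‖w - w₀‖ + ‖w₀‖ := by simpa using norm_add_le (w - w₀) w₀
    linarith
  let m : closedBall (0 : V) 1 × I → V := fun p =>
    (1 - p.2 * l p.1) • (p.1 : V) + (p.2 * l p.1) • w₀
  have hm : ∀ p, m p ∈ closedBall (0 : V) 1 := fun p => by
    refine convex_closedBall (0 : V) 1 p.1.2 (ball_subset_closedBall hw₀) ?_ ?_ (by ring)
    · exact sub_nonneg.2 (mul_le_one₀ p.2.2.2 (hl0 _ p.1.2) (hl1 _))
    · exact mul_nonneg p.2.2.1 (hl0 _ p.1.2)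
  have hmc : Continuous m := by
    have : Continuous fun p : closedBall (0 : V) 1 × I => l p.1 := by fun_prop
    fun_prop
  let F : C(closedBall (0 : V) 1 × I, X) := ⟨fun p => Q (m p), hQ.comp_continuous hmc hm⟩
  have hF0 : ∀ (w : closedBall (0 : V) 1) (u : I), l (w : V) = 0 → F (w, u) = Q w := fun w u h => by
    simp [F, m, h]
  refine ⟨⟨fun w => (t w, F.curry w), (htc.comp continuous_subtype_val).prodMk
    F.curry.continuous⟩, fun z => ?_, fun w => ⟨?_, fun h => ?_, fun h => ?_, fun h => ?_⟩⟩
  · have hz := (hφ z).2.2.1 (hA' z z.2)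
    have hlz := hlsph z z.2
    refine Prod.ext ?_ ?_
    · rw [hz.1]
      by_contra hne
      have h0 : 0 < t z := lt_of_le_of_ne (le_max_left _ _) (Ne.symm hne)
      have := htl z h0
      rw [hlz] at this
      exact zero_ne_one this
    · ext u
      rw [hz.2 u]
      exact hF0 _ u hlz
  · change Q (m (w, 0)) = _
    simp [m]
  · change Q (m (w, 1)) = _
    simp [m, htl w h]
  · by_cases hw : ‖(w : V)‖ = 1
    · have hlz := hlsph w (mem_sphere_zero_iff_norm.2 hw)
      refine ⟨?_, fun u => hF0 _ u hlz⟩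
      by_contra hne
      have h0 : 0 < t w := lt_of_le_of_ne (le_max_left _ _) (Ne.symm hne)
      have := htl w h0
      rw [hlz] at this
      exact zero_ne_one this
    · exact absurd h (hA w (mem_ball_zero_iff.2 (lt_of_le_of_ne (mem_closedBall_zero_iff.1 w.2) hw)))
  · by_cases hw : ‖(w : V)‖ = 1
    · have h1 := hA' w (mem_sphere_zero_iff_norm.2 hw)
      rw [h] at h1
      exact absurd h1 (hA w₀ hw₀)
    · have h1 : (w : V) = w₀ := hinj (mem_ball_zero_iff.2
        (lt_of_le_of_ne (mem_closedBall_zero_iff.1 w.2) hw)) hw₀ h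
      change 0 < t w
      simp [t, h1]

/-- Every point of a CW complex has an open neighbourhood that contracts to it in the complex. -/
theorem exists_isOpen_contraction [T2Space X] [CWComplex (univ : Set X)] (x : X) :
    ∃ W : Set X, IsOpen W ∧ x ∈ W ∧ ∃ G : C(W × I, X), (∀ w, G (w, 0) = w) ∧
      ∀ w, G (w, 1) = x := by
  obtain ⟨n₀, i₀, w₀, hw₀, hx⟩ : ∃ (n₀ : ℕ) (i₀ : RelCWComplex.cell (univ : Set X) n₀),
      x ∈ RelCWComplex.openCell n₀ i₀ := by
    have : x ∈ ⋃ (n : ℕ) (j : RelCWComplex.cell (univ : Set X) n),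
        RelCWComplex.openCell n j := by rw [CWComplex.iUnion_openCell_eq_complex]; trivial
    simpa only [mem_iUnion] using this
  subst hx
  -- The skeleton below the dimension of the open cell containing `x`. Cells inside it get weight
  -- zero and constant paths; the cell of `x` and the remaining cells are treated by the two
  -- extension lemmas.
  set A : Set X := (RelCWComplex.skeletonLT (univ : Set X) n₀ : Set X) with hA
  have hAopen : ∀ (n : ℕ) (i : RelCWComplex.cell (univ : Set X) n), n₀ ≤ n →
      ∀ w ∈ ball (0 : Fin n → ℝ) 1, RelCWComplex.map n i w ∉ A := fun n i hn w hw h =>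
    disjoint_left.1 (RelCWComplex.disjoint_skeletonLT_openCell (by exact_mod_cast hn)) h
      ⟨w, hw, rfl⟩
  set x := RelCWComplex.map n₀ i₀ w₀ with hxdef
  have hxA : x ∉ A := hAopen n₀ i₀ le_rfl w₀ hw₀
  obtain ⟨s, hs⟩ := exists_continuous_selection (IsPartialContraction A x)
    ⟨x, (1, ContinuousMap.const I x), rfl, fun _ => rfl, fun h => absurd h hxA,
      fun _ => one_pos⟩ (fun n i φ hφ => by
    have hQ := RelCWComplex.continuousOn n i
    rcases lt_or_ge n n₀ with hn | hn
    · have hsub : ∀ w ∈ closedBall (0 : Fin n → ℝ) 1, RelCWComplex.map n i w ∈ A := fun w hw => by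
        refine RelCWComplex.skeletonLT_mono ?_
          (RelCWComplex.closedCell_subset_skeletonLT n i ⟨w, hw, rfl⟩)
        exact_mod_cast hn
      let F : C(closedBall (0 : Fin n → ℝ) 1 × I, X) := ⟨fun p => RelCWComplex.map n i p.1,
        hQ.comp_continuous (by fun_prop) fun p => p.1.2⟩
      refine ⟨⟨fun w => (0, F.curry w), continuous_const.prodMk F.curry.continuous⟩,
        fun z => ?_, fun w => ⟨rfl, fun h => absurd h (lt_irrefl _), fun _ => ⟨rfl, fun _ => rfl⟩,
          fun h => ?_⟩⟩
      · have hz := (hφ z).2.2.1 (hsub z (sphere_subset_closedBall z.2))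
        exact Prod.ext hz.1.symm (ContinuousMap.ext fun u => (hz.2 u).symm)
      · exact absurd (hsub w w.2) (h ▸ hxA)
    · by_cases hin : (⟨n, i⟩ : Σ n, RelCWComplex.cell (univ : Set X) n) = ⟨n₀, i₀⟩
      · obtain ⟨rfl, hi⟩ := Sigma.mk.inj_iff.1 hin
        obtain rfl := eq_of_heq hi
        refine exists_extension_of_mem_ball hQ hw₀ (hAopen n i hn) (fun z hz =>
          RelCWComplex.cellFrontier_subset_skeletonLT n i ⟨z, hz, rfl⟩) ?_ φ hφ
        have := (RelCWComplex.map n i).injOn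
        rwa [RelCWComplex.source_eq] at this
      · refine exists_extension_of_notMem hQ (fun w hw => ⟨hAopen n i hn w hw, fun h => ?_⟩) φ hφ
        exact disjoint_left.1 (RelCWComplex.disjoint_openCell_of_ne hin) ⟨w, hw, rfl⟩
          ⟨w₀, hw₀, h.symm⟩)
  -- Positivity of the weight is an open condition, and it guarantees that the selected path ends at
  -- `x`.
  refine ⟨{y | 0 < (s y).1}, isOpen_lt continuous_const (continuous_fst.comp s.continuous),
    (hs x).2.2.2 rfl, ⟨fun p => (s p.1).2 p.2, ?_⟩, fun w => (hs w).1, fun w => (hs w).2.1 w.2⟩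
  exact (continuous_snd.comp (s.continuous.comp
    (continuous_subtype_val.comp continuous_fst))).eval continuous_snd

end LocalContraction

/-! ### Fibrewise contraction of homotopy fibres -/

section FibreContraction

open Topology Metric Set unitInterval

/-- If `f : B × X → X` is homotopic to the projection, then the fibrewise homotopy fibre of `f` over
`e` is fibrewise contractible: any family of its points can be deformed, over `B`, to a family
which only depends on the point of `B`. -/
theorem exists_fibre_contraction {B P X : Type*} [TopologicalSpace B] [TopologicalSpace P]
    [TopologicalSpace X] {f : C(B × X, X)} (K : f.Homotopy ContinuousMap.snd) (e : X)
    (w : C(P, B)) (y : C(P, X)) (γ : C(P, C(I, X))) (h0 : ∀ p, γ p 0 = f (w p, y p))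
    (h1 : ∀ p, γ p 1 = e) :
    ∃ C : C(P × I, X × C(I, X)), (∀ p, C (p, 0) = (y p, γ p)) ∧
      (∀ p, (C (p, 1)).1 = e ∧ ∀ u, (C (p, 1)).2 u = K (u, (w p, e))) ∧
      ∀ p t, (C (p, t)).2 0 = f (w p, (C (p, t)).1) ∧ (C (p, t)).2 1 = e := by
  let pr : ℝ → I := projIcc 0 1 zero_le_one
  have hpr : Continuous pr := continuous_projIcc
  have hpr0 : pr 0 = 0 := projIcc_left _
  have hpr1 : pr 1 = 1 := projIcc_right _
  have hprI : ∀ u : I, pr u = u := fun u => projIcc_of_mem _ u.2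
  let k : P → I → X := fun p u => K (u, (w p, y p))
  have hk0 : ∀ p, k p 0 = γ p 0 := fun p => by simp only [k, K.apply_zero, h0]
  have hk1 : ∀ p, k p 1 = y p := fun p => by simp [k]
  have hkc : Continuous (Function.uncurry k) := by
    change Continuous fun q : P × I => K (q.2, (w q.1, y q.1))
    fun_prop
  let g : P → I → X := fun p u => γ p u
  have hgc : Continuous (Function.uncurry g) :=
    (γ.continuous.comp continuous_fst).eval continuous_snd
  -- First stage: insert before `γ` an excursion along `k` to time `s` and back, so that `γ` grows
  -- into `k · k⁻¹ · γ`. The length is `1 + 2s`, and `y` stays fixed.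
  let A : (P × I) × ℝ → X := fun q => if q.2 ≤ 2 * (q.1.2 : ℝ) then
    k q.1.1 (pr (min q.2 (2 * q.1.2 - q.2))) else g q.1.1 (pr (q.2 - 2 * q.1.2))
  have hA : Continuous A := by
    refine Continuous.if_le ?_ ?_ (by fun_prop) (by fun_prop) fun q hq => ?_
    · exact hkc.comp (f := fun q : (P × I) × ℝ => (q.1.1, pr (min q.2 (2 * q.1.2 - q.2))))
        (by fun_prop)
    · exact hgc.comp (f := fun q : (P × I) × ℝ => (q.1.1, pr (q.2 - 2 * q.1.2)))
        (by fun_prop)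
    · rw [hq, sub_self, min_eq_right (by have := q.1.2.2.1; linarith), hpr0, hk0]
  let d : P → ℝ → X := glue (fun p u => k p (unitInterval.symm u)) g
  have hd' : ∀ p, k p (unitInterval.symm 1) = g p 0 := fun p => by rw [symm_one, hk0]
  have hdc : Continuous fun q : P × ℝ => d q.1 q.2 := by
    refine continuous_glue ?_ hgc hd'
    exact hkc.comp (f := fun q : P × I => (q.1, unitInterval.symm q.2)) (by fun_prop)
  have hd0 : ∀ p, d p 0 = y p := fun p => by
    simp only [d, glue_zero, symm_zero, hk1]
  have hd2 : ∀ p, d p 2 = e := fun p => by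
    simp only [d]
    rw [glue_two hd']
    exact h1 p
  -- Second stage: move `y` to `e` along `d = k⁻¹ · γ`. At time `s` the path is the trajectory of
  -- `K` at `d (2s)` followed by the rest of `d`, of total length `3 - 2s`; at the end only the
  -- trajectory at `e` is left.
  let A' : (P × I) × ℝ → X := fun q => if q.2 ≤ 1 then
    K (pr q.2, (w q.1.1, d q.1.1 (2 * q.1.2))) else d q.1.1 (2 * q.1.2 + (q.2 - 1))
  have hA' : Continuous A' := by
    have h2 : Continuous fun q : (P × I) × ℝ => d q.1.1 (2 * q.1.2) :=
      hdc.comp (f := fun q : (P × I) × ℝ => (q.1.1, 2 * (q.1.2 : ℝ))) (by fun_prop)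
    refine Continuous.if_le ?_ ?_ (by fun_prop) (by fun_prop) fun q hq => ?_
    · fun_prop
    · exact hdc.comp (f := fun q : (P × I) × ℝ => (q.1.1, 2 * (q.1.2 : ℝ) + (q.2 - 1)))
        (by fun_prop)
    · rw [hq, hpr1, sub_self, add_zero, K.apply_one]
      rfl
  -- Both stages are rescaled to unit length; where they meet, both have length `3`.
  let F₁ : C((P × I) × I, X) := ⟨fun q => A (q.1, q.2 * (1 + 2 * q.1.2)), by fun_prop⟩
  let F₂ : C((P × I) × I, X) := ⟨fun q => A' (q.1, q.2 * (3 - 2 * q.1.2)), by fun_prop⟩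
  let H₁ : P → I → X × C(I, X) := fun p s => (y p, F₁.curry (p, s))
  let H₂ : P → I → X × C(I, X) := fun p s => (d p (2 * s), F₂.curry (p, s))
  have hH₁ : Continuous (Function.uncurry H₁) :=
    (y.continuous.comp continuous_fst).prodMk F₁.curry.continuous
  have hH₂ : Continuous (Function.uncurry H₂) := by
    refine Continuous.prodMk ?_ F₂.curry.continuous
    exact hdc.comp (f := fun q : P × I => (q.1, 2 * (q.2 : ℝ))) (by fun_prop)
  have hH : ∀ p, H₁ p 1 = H₂ p 0 := by
    intro p
    refine Prod.ext ?_ (ContinuousMap.ext fun u => ?_)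
    · simp [H₁, H₂, hd0]
    · change A ((p, 1), u * (1 + 2 * (1 : I))) = A' ((p, 0), u * (3 - 2 * (0 : I)))
      have e1 : (u * (1 + 2 * ((1 : I) : ℝ)) : ℝ) = 3 * u := by rw [Icc.coe_one]; ring
      have e2 : (u * (3 - 2 * ((0 : I) : ℝ)) : ℝ) = 3 * u := by rw [Icc.coe_zero]; ring
      rw [e1, e2]
      generalize (3 * u : ℝ) = v
      simp only [A, A', Icc.coe_one, Icc.coe_zero, mul_one, mul_zero, zero_add, hd0]
      by_cases hv1 : v ≤ 1
      · rw [if_pos (by linarith), if_pos hv1, min_eq_left (by linarith)]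
      · rw [if_neg hv1]
        simp only [d, glue]
        by_cases hv2 : v ≤ 2
        · rw [if_pos hv2, if_pos (by linarith), min_eq_right (by linarith)]
          congr 1
          have hm : v - 1 ∈ Icc (0 : ℝ) 1 := ⟨by linarith, by linarith⟩
          have hm' : 2 - v ∈ Icc (0 : ℝ) 1 := ⟨by linarith, by linarith⟩
          simp only [pr]
          rw [projIcc_of_mem _ hm, projIcc_of_mem _ hm']
          ext1
          simp only [coe_symm_eq]
          ring
        · rw [if_neg hv2, if_neg (by linarith)]
          congr 2
          ring
  have hend₁ : ∀ p s, (H₁ p s).2 0 = f (w p, (H₁ p s).1) ∧ (H₁ p s).2 1 = e := by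
    intro p s
    have hs := s.2.1
    constructor
    · change A ((p, s), (0 : I) * (1 + 2 * s)) = f (w p, y p)
      simp only [A, Icc.coe_zero, zero_mul, sub_zero]
      rw [if_pos (by linarith), min_eq_left (by linarith), hpr0, hk0, h0]
    · change A ((p, s), (1 : I) * (1 + 2 * s)) = e
      simp only [A, Icc.coe_one, one_mul, add_sub_cancel_right]
      rw [if_neg (by linarith), hpr1]
      exact h1 p
  have hend₂ : ∀ p s, (H₂ p s).2 0 = f (w p, (H₂ p s).1) ∧ (H₂ p s).2 1 = e := by
    intro p s
    constructor
    · change A' ((p, s), (0 : I) * (3 - 2 * s)) = f (w p, d p (2 * s))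
      simp only [A', Icc.coe_zero, zero_mul]
      rw [if_pos zero_le_one, hpr0, K.apply_zero]
    · change A' ((p, s), (1 : I) * (3 - 2 * s)) = e
      simp only [A', Icc.coe_one, one_mul]
      by_cases hs : (3 - 2 * s : ℝ) ≤ 1
      · have hs1 : (s : ℝ) = 1 := le_antisymm s.2.2 (by linarith)
        rw [if_pos hs, hs1, show (3 - 2 * 1 : ℝ) = 1 by norm_num, hpr1, K.apply_one, mul_one]
        exact hd2 p
      · rw [if_neg hs, show (2 * s + (3 - 2 * s - 1) : ℝ) = 2 by ring, hd2]
  have hC : Continuous fun q : P × I => glue H₁ H₂ q.1 (2 * q.2) :=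
    (continuous_glue hH₁ hH₂ hH).comp (f := fun q : P × I => (q.1, 2 * (q.2 : ℝ))) (by fun_prop)
  refine ⟨⟨_, hC⟩, fun p => ?_, fun p => ?_, fun p t => ?_⟩
  · simp only [ContinuousMap.coe_mk, Icc.coe_zero, mul_zero, glue_zero]
    refine Prod.ext rfl (ContinuousMap.ext fun u => ?_)
    change A ((p, 0), u * (1 + 2 * (0 : I))) = γ p u
    simp only [A, Icc.coe_zero, mul_zero, add_zero, mul_one, sub_zero, zero_sub]
    by_cases hu : (u : ℝ) ≤ 0
    · have hu0 : u = 0 := Subtype.ext (le_antisymm hu u.2.1)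
      subst hu0
      simp [hpr0, hk0]
    · rw [if_neg hu, hprI]
  · simp only [ContinuousMap.coe_mk, Icc.coe_one, mul_one, glue_two hH]
    refine ⟨by simp [H₂, hd2], fun u => ?_⟩
    change A' ((p, 1), u * (3 - 2 * (1 : I))) = _
    simp only [A', Icc.coe_one, mul_one, hd2]
    rw [show (u * (3 - 2) : ℝ) = u by ring, if_pos u.2.2, hprI]
  · simp only [ContinuousMap.coe_mk]
    unfold glue
    split_ifs
    · exact hend₁ _ _
    · exact hend₂ _ _

end FibreContraction

/-! ### A left homotopy inverse on an H-space -/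

section Inverse

open Topology Metric Set unitInterval

/-- Extension over a ball of a family of points of the homotopy fibres of the right translations
of an H-space. -/
theorem exists_extension_translation {V X : Type*} [NormedAddCommGroup V] [NormedSpace ℝ V]
    [ProperSpace V] [TopologicalSpace X] [PathConnectedSpace X] [HSpace X] {Q : V → X}
    (hQ : ContinuousOn Q (closedBall 0 1)) (φ : C(sphere (0 : V) 1, X × C(I, X)))
    (hφ : ∀ z : sphere (0 : V) 1,
      (φ z).2 0 = HSpace.hmul ((φ z).1, Q z) ∧ (φ z).2 1 = HSpace.e) :
    ∃ ψ : C(closedBall (0 : V) 1, X × C(I, X)),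
      (∀ z : sphere (0 : V) 1, ψ ⟨z, sphere_subset_closedBall z.2⟩ = φ z) ∧
      ∀ w : closedBall (0 : V) 1,
        (ψ w).2 0 = HSpace.hmul ((ψ w).1, Q w) ∧ (ψ w).2 1 = HSpace.e := by
  let B := closedBall (0 : V) 1
  let q : C(B, X) := ⟨fun w => Q w, continuousOn_iff_continuous_domRestrict.1 hQ⟩
  have hB : ContractibleSpace B := (convex_closedBall (0 : V) 1).contractibleSpace
    ⟨0, mem_closedBall_self zero_le_one⟩
  have hq : q.Homotopic (ContinuousMap.const B HSpace.e) := by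
    obtain ⟨b, hb⟩ := id_nullhomotopic B
    have h1 : q.Homotopic (ContinuousMap.const B (q b)) := by
      simpa using (ContinuousMap.Homotopic.refl q).comp hb
    refine h1.trans ?_
    have : Nonempty B := ⟨b⟩
    exact ContinuousMap.homotopic_const_iff.2 (PathConnectedSpace.joined _ _)
  let f : C(B × X, X) := HSpace.hmul.comp (ContinuousMap.snd.prodMk (q.comp ContinuousMap.fst))
  -- Contract the ball, join the resulting point to `e`, and use that `e` is a right unit up to
  -- homotopy.
  have hf : f.Homotopic ContinuousMap.snd := by
    have h1 : f.Homotopic (HSpace.hmul.comp (ContinuousMap.snd.prodMk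
        ((ContinuousMap.const B HSpace.e).comp ContinuousMap.fst))) :=
      (ContinuousMap.Homotopic.refl _).comp
        ((ContinuousMap.Homotopic.refl _).prodMk (hq.comp (ContinuousMap.Homotopic.refl _)))
    refine h1.trans ?_
    have h2 : (HSpace.hmul.comp ((ContinuousMap.id X).prodMk
        (ContinuousMap.const X HSpace.e))).Homotopic (ContinuousMap.id X) :=
      ⟨HSpace.hmulE.toHomotopy⟩
    exact h2.comp (ContinuousMap.Homotopic.refl (ContinuousMap.snd : C(B × X, X)))
  obtain ⟨K⟩ := hf
  let a : sphere (0 : V) 1 → I → X := fun z r => HSpace.hmul ((φ z).1, radial Q z r)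
  let b : sphere (0 : V) 1 → I → X := fun z u => (φ z).2 u
  have hφ1 : Continuous fun z : sphere (0 : V) 1 => (φ z).1 := continuous_fst.comp φ.continuous
  have ha : Continuous (Function.uncurry a) :=
    HSpace.hmul.continuous.comp ((hφ1.comp continuous_fst).prodMk (continuous_radial hQ))
  have hb : Continuous (Function.uncurry b) := by
    have : Continuous fun z : sphere (0 : V) 1 => (φ z).2 := continuous_snd.comp φ.continuous
    exact (this.comp continuous_fst).eval continuous_snd
  have hab : ∀ z, a z 1 = b z 0 := fun z => by
    simp only [a, radial, Icc.coe_one, one_smul, b, (hφ z).1]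
  have hΘ := continuous_glue ha hb hab
  -- Over `r • z` keep the point `(φ z).1`, and prefix its path by the trace of the translations
  -- from `r • z` out to `z`.
  let F : C((sphere (0 : V) 1 × I) × I, X) := ⟨fun p => glue a b p.1.1
    ((p.1.2 : ℝ) + (p.2 : ℝ) * (2 - (p.1.2 : ℝ))), by
      exact hΘ.comp (f := fun p : (sphere (0 : V) 1 × I) × I =>
        (p.1.1, (p.1.2 : ℝ) + (p.2 : ℝ) * (2 - (p.1.2 : ℝ)))) (by fun_prop)⟩
  let w : C(sphere (0 : V) 1 × I, B) :=
    ⟨fun p => ⟨(p.2 : ℝ) • (p.1 : V), smul_mem_closedBall p.1 p.2⟩, by fun_prop⟩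
  let y : C(sphere (0 : V) 1 × I, X) := ⟨fun p => (φ p.1).1, hφ1.comp continuous_fst⟩
  obtain ⟨C, hC0, hC1, hCend⟩ := exists_fibre_contraction K HSpace.e w y F.curry
    (fun p => by
      change glue a b p.1 _ = HSpace.hmul ((φ p.1).1, Q _)
      rw [Icc.coe_zero, zero_mul, add_zero, glue_left]
      rfl)
    (fun p => by
      change glue a b p.1 _ = _
      rw [Icc.coe_one, one_mul, add_sub_cancel, glue_two hab]
      exact (hφ p.1).2)
  let w₀ : B := ⟨0, mem_closedBall_self zero_le_one⟩
  let c : X × C(I, X) := (HSpace.e, ⟨fun u => K (u, (w₀, HSpace.e)), by fun_prop⟩)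
  -- Contract progressively towards the centre, by time `1 - r` at radius `r`: nothing happens at
  -- the boundary, and at the centre the value no longer depends on the direction.
  refine exists_ball_extension
    (R := fun w a => a.2 0 = HSpace.hmul (a.1, Q w) ∧ a.2 1 = HSpace.e)
    (g := fun p => C (p, unitInterval.symm p.2)) (by fun_prop) (fun z => ?_) (c := c)
    (fun z => ?_) hφ ⟨?_, ?_⟩ fun z r _ => hCend (z, r) _
  · simp only [symm_one, hC0]
    refine Prod.ext rfl (ContinuousMap.ext fun u => ?_)
    change glue a b z _ = _
    rw [Icc.coe_one, show (1 + (u : ℝ) * (2 - 1) : ℝ) = 1 + u by ring, glue_right hab]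
  · simp only [symm_zero]
    refine Prod.ext (hC1 _).1 (ContinuousMap.ext fun u => ?_)
    rw [(hC1 _).2 u]
    have : w (z, 0) = w₀ := Subtype.ext (by simp [w, w₀])
    rw [this]
    rfl
  · change K (0, _) = _
    rw [K.apply_zero]
    rfl
  · change K (1, _) = _
    rw [K.apply_one]
    rfl

/-- A path-connected CW complex that is an H-space has a homotopy left inverse. -/
theorem exists_leftInverse {X : Type*} [TopologicalSpace X] [T2Space X]
    [CWComplex (univ : Set X)] [PathConnectedSpace X] [HSpace X] :
    ∃ j : C(X, X), (HSpace.hmul.comp (j.prodMk (ContinuousMap.id X))).Homotopic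
      (ContinuousMap.const X HSpace.e) := by
  obtain ⟨s, hs⟩ := exists_continuous_selection
    (fun (x : X) (a : X × C(I, X)) => a.2 0 = HSpace.hmul (a.1, x) ∧ a.2 1 = HSpace.e)
    ⟨HSpace.e, (HSpace.e, ContinuousMap.const I HSpace.e), HSpace.hmul_e_e.symm, rfl⟩
    (fun n i φ hφ => exists_extension_translation (RelCWComplex.continuousOn n i) φ hφ)
  refine ⟨⟨fun x => (s x).1, continuous_fst.comp s.continuous⟩, ⟨⟨⟨fun p => (s p.2).2 p.1, ?_⟩,
    fun x => (hs x).1, fun x => (hs x).2⟩⟩⟩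
  exact (continuous_snd.comp (s.continuous.comp continuous_snd)).eval continuous_fst

end Inverse

/-! ### Calculus of path classes -/

section PathClasses

open Topology Set unitInterval

variable {X Y : Type*} [TopologicalSpace X] [TopologicalSpace Y]

theorem trans_left_cancel {a b c : X} (p : Path.Homotopic.Quotient a b)
    {q r : Path.Homotopic.Quotient b c} (h : p.trans q = p.trans r) : q = r := by
  have := congrArg p.symm.trans h
  simpa only [← Path.Homotopic.Quotient.trans_assoc, Path.Homotopic.Quotient.symm_trans, Path.Homotopic.Quotient.refl_trans] using this

theorem trans_right_cancel {a b c : X} (p : Path.Homotopic.Quotient b c)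
    {q r : Path.Homotopic.Quotient a b} (h : q.trans p = r.trans p) : q = r := by
  have := congrArg (fun x => x.trans p.symm) h
  simpa only [Path.Homotopic.Quotient.trans_assoc, Path.Homotopic.Quotient.trans_symm, Path.Homotopic.Quotient.trans_refl] using this

theorem quotient_map_trans (f : C(X, Y)) {a b c : X} (p : Path.Homotopic.Quotient a b)
    (q : Path.Homotopic.Quotient b c) : (p.trans q).map f = (p.map f).trans (q.map f) := by
  induction p using Path.Homotopic.Quotient.ind with | mk p =>
  induction q using Path.Homotopic.Quotient.ind with | mk q =>
  exact congrArg Path.Homotopic.Quotient.mk (p.map_trans q f.continuous)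

theorem quotient_map_symm (f : C(X, Y)) {a b : X} (p : Path.Homotopic.Quotient a b) :
    p.symm.map f = (p.map f).symm := by
  induction p using Path.Homotopic.Quotient.ind with | mk p =>
  rfl

/-- Naturality of the trajectories of a homotopy, in terms of homotopy classes. -/
theorem quotient_map_trans_evalAt {f g : C(X, Y)} (F : f.Homotopy g) {a b : X}
    (p : Path.Homotopic.Quotient a b) :
    (p.map f).trans (Path.Homotopic.Quotient.mk (F.evalAt b)) = (Path.Homotopic.Quotient.mk (F.evalAt a)).trans (p.map g) := by
  induction p using Path.Homotopic.Quotient.ind with | mk p =>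
  exact Path.Homotopic.Quotient.eq.2 (Path.Homotopic.map_trans_evalAt F p)

/-- Homotopic maps trivialise the same loops. -/
theorem quotient_map_eq_refl_of_homotopic {f g : C(X, Y)} (h : f.Homotopic g) {a : X}
    {p : Path.Homotopic.Quotient a a} (hp : p.map f = Path.Homotopic.Quotient.refl (f a)) :
    p.map g = Path.Homotopic.Quotient.refl (g a) := by
  obtain ⟨F⟩ := h
  have := quotient_map_trans_evalAt F p
  rw [hp, Path.Homotopic.Quotient.refl_trans] at this
  refine trans_left_cancel (Path.Homotopic.Quotient.mk (F.evalAt a)) ?_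
  rw [← this, Path.Homotopic.Quotient.trans_refl]

theorem quotient_map_const (c : Y) {a b : X} (p : Path.Homotopic.Quotient a b) :
    p.map (ContinuousMap.const X c) = Path.Homotopic.Quotient.refl c := by
  induction p using Path.Homotopic.Quotient.ind with | mk p =>
  rfl

theorem quotient_map_id {a b : X} (p : Path.Homotopic.Quotient a b) :
    p.map (ContinuousMap.id X) = p := by
  induction p using Path.Homotopic.Quotient.ind with | mk p =>
  rfl

theorem quotient_map_conj (f : C(X, Y)) {a b : X} (p : Path.Homotopic.Quotient a a)
    (q : Path.Homotopic.Quotient a b) : (q.symm.trans (p.trans q)).map f =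
      (q.map f).symm.trans ((p.map f).trans (q.map f)) := by
  rw [quotient_map_trans, quotient_map_trans, quotient_map_symm]

theorem conj_refl {a b : X} (q : Path.Homotopic.Quotient a b) :
    q.symm.trans ((Path.Homotopic.Quotient.refl a).trans q) =
      Path.Homotopic.Quotient.refl b := by
  rw [Path.Homotopic.Quotient.refl_trans, Path.Homotopic.Quotient.symm_trans]

theorem eq_refl_of_conj_eq_refl {a b : X} {p : Path.Homotopic.Quotient a a}
    {q : Path.Homotopic.Quotient a b}
    (h : q.symm.trans (p.trans q) = Path.Homotopic.Quotient.refl b) :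
    p = Path.Homotopic.Quotient.refl a :=
  trans_right_cancel q (trans_left_cancel q.symm (h.trans (conj_refl q).symm))

/-- In a set that contracts in `X`, paths with the same endpoints are homotopic in `X`. -/
theorem homotopic_of_contraction {W : Set X} {x : X} (G : C(W × I, X))
    (hG0 : ∀ w, G (w, 0) = w) (hG1 : ∀ w, G (w, 1) = x) {a b : X} (η θ : Path a b)
    (hη : ∀ t, η t ∈ W) (hθ : ∀ t, θ t ∈ W) : Path.Homotopic.Quotient.mk η = Path.Homotopic.Quotient.mk θ := by
  let i : C(W, X) := ⟨Subtype.val, continuous_subtype_val⟩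
  let F : i.Homotopy (ContinuousMap.const W x) :=
    ⟨⟨fun p => G (p.2, p.1), by fun_prop⟩, hG0, hG1⟩
  have ha : a ∈ W := by simpa using hη 0
  have hb : b ∈ W := by simpa using hη 1
  have key : ∀ ζ : Path a b, (∀ t, ζ t ∈ W) →
      (Path.Homotopic.Quotient.mk ζ).trans (Path.Homotopic.Quotient.mk (F.evalAt ⟨b, hb⟩)) =
        Path.Homotopic.Quotient.mk (F.evalAt ⟨a, ha⟩) := by
    intro ζ hζ
    let ζ' : Path (⟨a, ha⟩ : W) ⟨b, hb⟩ :=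
      ⟨⟨fun t => ⟨ζ t, hζ t⟩, by fun_prop⟩, Subtype.ext ζ.source, Subtype.ext ζ.target⟩
    have := quotient_map_trans_evalAt F (Path.Homotopic.Quotient.mk ζ')
    rw [quotient_map_const] at this
    exact this.trans (Path.Homotopic.Quotient.trans_refl _)
  exact trans_right_cancel _ ((key η hη).trans (key θ hθ).symm)

end PathClasses

/-! ### Sections of the universal cover and null-homotopic loops -/

section LocalSections

open Topology Set unitInterval

variable {X : Type*} [TopologicalSpace X] {x₀ : X}

/-- The class in `X` of a path in `V`. -/
def coeClass {V : Set X} {a b : V} (p : Path.Homotopic.Quotient a b) :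
    Path.Homotopic.Quotient (a : X) (b : X) :=
  p.map ⟨Subtype.val, continuous_subtype_val⟩

theorem coeClass_trans {V : Set X} {a b c : V} (p : Path.Homotopic.Quotient a b)
    (q : Path.Homotopic.Quotient b c) :
    coeClass (p.trans q) = (coeClass p).trans (coeClass q) :=
  quotient_map_trans _ p q

theorem coeClass_symm {V : Set X} {a b : V} (p : Path.Homotopic.Quotient a b) :
    coeClass p.symm = (coeClass p).symm :=
  quotient_map_symm _ p

/-- The loops in `V` are null-homotopic in `X`. -/
def LoopsTrivialIn (V : Set X) : Prop :=
  ∀ (v : V) (p : Path.Homotopic.Quotient v v),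
    coeClass p = Path.Homotopic.Quotient.refl (v : X)

theorem UniversalCover.exists_path_of_mem_basicOpen {b b' : UniversalCover x₀} {U : Set X}
    (h : b' ∈ UniversalCover.basicOpen b U) {x x' : X} (hx : b.pt = x) (hx' : b'.pt = x') :
    ∃ η : Path x x', (∀ t, η t ∈ U) ∧
      b'.cls.cast rfl hx'.symm = (b.cls.cast rfl hx.symm).trans (Path.Homotopic.Quotient.mk η) := by
  subst hx hx'
  simpa [UniversalCover.basicOpen] using h

/-- Let `c` be the path class picked by the section and `β` a loop. Then `c (β t)` followed by the
rest of `β` is locally constant in `t`: in a neighbourhood contracting in `X`, the path given by the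
topology of the cover is homotopic to the piece of `β`. Comparing `t = 0` with `t = 1` gives `c · β
= c`. -/
theorem loopsTrivialIn_of_section [T2Space X] [CWComplex (univ : Set X)] {V : Set X}
    (s : C(V, UniversalCover x₀)) (hs : ∀ v, UniversalCover.proj x₀ (s v) = v) :
    LoopsTrivialIn V := by
  intro v p
  induction p using Path.Homotopic.Quotient.ind with | mk α =>
  let β : Path (v : X) v := α.map continuous_subtype_val
  change Path.Homotopic.Quotient.mk β = _
  let c : ∀ w : V, Path.Homotopic.Quotient x₀ (w : X) := fun w => (s w).cls.cast rfl (hs w).symm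
  let c' : ∀ t, Path.Homotopic.Quotient x₀ (β t) := fun t => c (α t)
  let g : I → Path.Homotopic.Quotient x₀ (v : X) := fun t =>
    (c' t).trans (Path.Homotopic.Quotient.mk ((β.subpath t 1).cast rfl β.target.symm))
  have hg : IsLocallyConstant g := by
    rw [IsLocallyConstant.iff_eventually_eq]
    intro t₀
    obtain ⟨W, hW, hxW, G, hG0, hG1⟩ := exists_isOpen_contraction (β t₀)
    have h1 : ∀ᶠ t in 𝓝 t₀, s (α t) ∈ UniversalCover.basicOpen (s (α t₀)) W := by
      have hpt : (s (α t₀)).pt ∈ W := by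
        have : (s (α t₀)).pt = β t₀ := hs _
        rwa [this]
      have hopen : IsOpen (UniversalCover.basicOpen (s (α t₀)) W) :=
        TopologicalSpace.isOpen_generateFrom_of_mem ⟨_, W, hW, hpt, rfl⟩
      refine (s.continuous.comp α.continuous).continuousAt.eventually (hopen.mem_nhds ?_)
      refine ⟨Path.refl _, fun _ => hpt, ?_⟩
      exact (Path.Homotopic.Quotient.trans_refl _).symm
    have h2 : ∀ᶠ t in 𝓝 t₀, uIcc t₀ t ⊆ β ⁻¹' W := by
      have : Filter.Tendsto (fun t => uIcc t₀ t) (𝓝 t₀) (𝓝 t₀).smallSets :=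
        tendsto_const_nhds.uIcc Filter.tendsto_id
      exact this.eventually (Filter.eventually_smallSets_subset.2
        ((hW.preimage β.continuous).mem_nhds hxW))
    filter_upwards [h1, h2] with t ht1 ht2
    obtain ⟨η, hηW, hη⟩ := UniversalCover.exists_path_of_mem_basicOpen ht1
      (show (s (α t₀)).pt = β t₀ from hs _) (show (s (α t)).pt = β t from hs _)
    have hsub : ∀ u, β.subpath t₀ t u ∈ W := fun u => by
      have : β.subpath t₀ t u ∈ range (β.subpath t₀ t) := mem_range_self u
      rw [Path.range_subpath] at this
      obtain ⟨r, hr, hr'⟩ := this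
      rw [← hr']
      exact ht2 hr
    have hηβ := homotopic_of_contraction G hG0 hG1 η (β.subpath t₀ t) hηW hsub
    have hct : c' t = (c' t₀).trans (Path.Homotopic.Quotient.mk (β.subpath t₀ t)) := by
      rw [← hηβ]; exact hη
    change (c' t).trans _ = (c' t₀).trans _
    rw [hct, Path.Homotopic.Quotient.trans_assoc]
    congr 1
    have h3 : (Path.Homotopic.Quotient.mk (β.subpath t₀ t)).trans (Path.Homotopic.Quotient.mk (β.subpath t 1)) =
        Path.Homotopic.Quotient.mk (β.subpath t₀ 1) :=
      Path.Homotopic.Quotient.eq.2 ⟨Path.Homotopy.subpathTransSubpath β t₀ t 1⟩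
    have h4 : ∀ (x : X) (hx : x = β 1), (Path.Homotopic.Quotient.mk (β.subpath t₀ t)).trans
        (Path.Homotopic.Quotient.mk ((β.subpath t 1).cast rfl hx)) =
        Path.Homotopic.Quotient.mk ((β.subpath t₀ 1).cast rfl hx) := by
      rintro x rfl
      exact h3
    exact h4 _ _
  have h01 : g 0 = g 1 := hg.apply_eq_of_isPreconnected isPreconnected_univ trivial trivial
  have hval : ∀ (w : V) (h : w = v) (δ : Path (w : X) (v : X)) (ε : Path (v : X) v),
      (∀ u, δ u = ε u) → (c w).trans (Path.Homotopic.Quotient.mk δ) = (c v).trans (Path.Homotopic.Quotient.mk ε) := by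
    rintro w rfl δ ε h
    rw [Path.ext (funext h)]
  have hg0 : g 0 = (c v).trans (Path.Homotopic.Quotient.mk β) :=
    hval (α 0) α.source _ _ fun u => by
      change β (Icc.convexComb 0 1 u) = β u
      simp
  have hg1 : g 1 = (c v).trans (Path.Homotopic.Quotient.mk (Path.refl _)) :=
    hval (α 1) α.target _ _ fun u => by
      change β (Icc.convexComb 1 1 u) = v
      simp
  rw [hg0, hg1] at h01
  exact trans_left_cancel _ h01

/-- Fix a point in each path component of `V` and a path to it from `x₀`, then continue inside `V`.
The class in `X` does not depend on the continuation because loops of `V` die there; continuity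
follows by joining nearby points by short paths. -/
theorem exists_section_of_loopsTrivialIn [PathConnectedSpace X] [LocallyPathConnectedSpace X]
    {V : Set X} (hV : IsOpen V) (h : LoopsTrivialIn V) :
    ∃ s : C(V, UniversalCover x₀), ∀ v, UniversalCover.proj x₀ (s v) = v := by
  classical
  have := hV.locallyPathConnectedSpace
  have hloop : ∀ {a b : V} (p q : Path.Homotopic.Quotient a b),
      coeClass p = coeClass q := by
    intro a b p q
    have := h a (p.trans q.symm)
    rw [coeClass_trans, coeClass_symm] at this
    exact trans_right_cancel (coeClass q).symm
      (this.trans (Path.Homotopic.Quotient.trans_symm _).symm)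
  let r : V → V := fun w => Quotient.out (s := pathSetoid V) (Quotient.mk _ w)
  have hr : ∀ w, Joined (r w) w := fun w => Quotient.mk_out (s := pathSetoid V) w
  have hrr : ∀ w w', Joined w w' → r w' = r w := fun w w' hw => by
    simp only [r]
    congr 1
    exact Quotient.sound (s := pathSetoid V) hw.symm
  let δ : ∀ w, Path (r w) w := fun w => (hr w).somePath
  let ε : ∀ w : V, Path x₀ (w : X) := fun w => PathConnectedSpace.somePath _ _
  let f : V → UniversalCover x₀ := fun w =>
    ⟨w, (Path.Homotopic.Quotient.mk (ε (r w))).trans (coeClass (Path.Homotopic.Quotient.mk (δ w)))⟩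
  have hf : ∀ (w w' : V) (η : Path w w'),
      (f w').cls = (f w).cls.trans (coeClass (Path.Homotopic.Quotient.mk η)) := by
    intro w w' η
    have key : ∀ (r₁ : V) (_ : r₁ = r w) (δ₁ : Path r₁ w'),
        (Path.Homotopic.Quotient.mk (ε r₁)).trans (coeClass (Path.Homotopic.Quotient.mk δ₁)) =
          ((Path.Homotopic.Quotient.mk (ε (r w))).trans (coeClass (Path.Homotopic.Quotient.mk (δ w)))).trans
            (coeClass (Path.Homotopic.Quotient.mk η)) := by
      rintro r₁ rfl δ₁
      rw [Path.Homotopic.Quotient.trans_assoc, ← coeClass_trans, ← Path.Homotopic.Quotient.mk_trans,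
        hloop (Path.Homotopic.Quotient.mk δ₁) (Path.Homotopic.Quotient.mk ((δ w).trans η))]
    exact key (r w') (hrr w w' ⟨η⟩) (δ w')
  refine ⟨⟨f, continuous_generateFrom_iff.2 ?_⟩, fun v => rfl⟩
  rintro S ⟨a, U, hU, -, rfl⟩
  rw [isOpen_iff_mem_nhds]
  rintro w ⟨η, hηU, hη⟩
  have hwU : (w : X) ∈ U := by simpa using hηU 1
  have hU' : IsOpen ((↑) ⁻¹' U : Set V) := hU.preimage continuous_subtype_val
  filter_upwards [pathComponentIn_mem_nhds (hU'.mem_nhds hwU)] with w' hw'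
  obtain ⟨θ, hθ⟩ := hw'
  refine ⟨η.trans (θ.map continuous_subtype_val), fun t => ?_, ?_⟩
  · have : η.trans (θ.map continuous_subtype_val) t ∈
        range (η.trans (θ.map continuous_subtype_val)) := mem_range_self t
    rw [Path.trans_range] at this
    rcases this with ⟨u, hu⟩ | ⟨u, hu⟩
    · rw [← hu]; exact hηU u
    · rw [← hu]; exact hθ u
  · refine (hf w w' θ).trans ?_
    rw [hη]
    exact Path.Homotopic.Quotient.trans_assoc _ _ _

end LocalSections

/-! ### Diagonal sets, slices and preimages under difference maps -/

section DiagonalSets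

open Topology Set unitInterval

variable {X : Type*} [TopologicalSpace X] {x₀ : X}

theorem isDiagonalSet_iff {U : Set (X × X)} : IsDiagonalSet x₀ U ↔
    ∀ u : U, ∃ γ : Path (u : X × X) (x₀, x₀), ∀ p : Path.Homotopic.Quotient u u,
      ((Path.Homotopic.Quotient.mk γ).symm.trans ((coeClass p).trans (Path.Homotopic.Quotient.mk γ))).map
          ContinuousMap.fst =
        ((Path.Homotopic.Quotient.mk γ).symm.trans ((coeClass p).trans (Path.Homotopic.Quotient.mk γ))).map
          ContinuousMap.snd := by
  refine forall_congr' fun u => exists_congr fun γ => ⟨fun h p => ?_, ?_⟩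
  · exact h ⟨p, rfl⟩
  · rintro h _ ⟨p, rfl⟩
    exact h p

/-- The slice of a diagonal set has only loops that are trivial in the whole space. -/
theorem IsDiagonalSet.loopsTrivialIn_slice {U : Set (X × X)} (h : IsDiagonalSet x₀ U) (y : X) :
    LoopsTrivialIn {x | (x, y) ∈ U} := by
  intro v p
  rw [isDiagonalSet_iff] at h
  let i : C({x | (x, y) ∈ U}, U) := ⟨fun v => ⟨(v, y), v.2⟩, by fun_prop⟩
  obtain ⟨γ, hγ⟩ := h (i v)
  have h1 : (coeClass (p.map i)).map ContinuousMap.fst = coeClass p := by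
    induction p using Path.Homotopic.Quotient.ind with | mk p =>
    rfl
  have h2 : (coeClass (p.map i)).map ContinuousMap.snd =
      Path.Homotopic.Quotient.refl (ContinuousMap.snd (i v : X × X)) := by
    induction p using Path.Homotopic.Quotient.ind with | mk p =>
    rfl
  have h3 := hγ (p.map i)
  rw [quotient_map_conj, quotient_map_conj, h2] at h3
  exact h1.symm.trans (eq_refl_of_conj_eq_refl (h3.trans (conj_refl _)))

/-- A class whose image under a difference map is trivial has equal components. -/
theorem eq_of_map_prod_eq_refl {Y : Type*} [TopologicalSpace Y] {d : C(X × X, Y)}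
    {e : Y} (hd : (d.comp ((ContinuousMap.id X).prodMk (ContinuousMap.id X))).Homotopic
      (ContinuousMap.const X e))
    (hd' : ∀ p : Path.Homotopic.Quotient x₀ x₀,
      p.map (d.comp ((ContinuousMap.const X x₀).prodMk (ContinuousMap.id X))) =
        Path.Homotopic.Quotient.refl (d (x₀, x₀)) → p = Path.Homotopic.Quotient.refl x₀)
    {a b : Path.Homotopic.Quotient x₀ x₀}
    (hp : (Path.Homotopic.prod a b).map d = Path.Homotopic.Quotient.refl (d (x₀, x₀))) :
    a = b := by
  -- The factorisation `(a, b) = (a, a) (1, a⁻¹b)`.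
  have h1 : Path.Homotopic.prod a b = (Path.Homotopic.prod a a).trans
      (Path.Homotopic.prod (Path.Homotopic.Quotient.refl x₀) (a.symm.trans b)) := by
    rw [Path.Homotopic.comp_prod_eq_prod_comp, Path.Homotopic.Quotient.trans_refl,
      ← Path.Homotopic.Quotient.trans_assoc, Path.Homotopic.Quotient.trans_symm,
      Path.Homotopic.Quotient.refl_trans]
  have h2 : Path.Homotopic.prod a a =
      a.map ((ContinuousMap.id X).prodMk (ContinuousMap.id X)) := by
    clear h1 hp
    induction a using Path.Homotopic.Quotient.ind with | mk a =>
    rfl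
  have h3 : ∀ c : Path.Homotopic.Quotient x₀ x₀, Path.Homotopic.prod (Path.Homotopic.Quotient.refl x₀) c =
      c.map ((ContinuousMap.const X x₀).prodMk (ContinuousMap.id X)) := by
    intro c
    induction c using Path.Homotopic.Quotient.ind with | mk c =>
    rfl
  have h4 : (Path.Homotopic.prod a a).map d = Path.Homotopic.Quotient.refl (d (x₀, x₀)) := by
    rw [h2]
    have := quotient_map_eq_refl_of_homotopic hd.symm (quotient_map_const e a)
    rwa [Path.Homotopic.Quotient.map_comp] at this
  have h5 : (Path.Homotopic.prod (Path.Homotopic.Quotient.refl x₀) (a.symm.trans b)).map d =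
      Path.Homotopic.Quotient.refl (d (x₀, x₀)) := by
    rw [h1, quotient_map_trans, h4, Path.Homotopic.Quotient.refl_trans] at hp
    exact hp
  rw [h3] at h5
  have h6 := hd' (a.symm.trans b) (by rw [Path.Homotopic.Quotient.map_comp]; exact h5)
  exact (trans_left_cancel a.symm (h6.trans (Path.Homotopic.Quotient.symm_trans a).symm)).symm

/-- Loops of `d ⁻¹' V` map to loops of `V`, so `d` kills them in `Y`. Being killed is invariant
under change of base point, hence any path to `(x₀, x₀)` serves. -/
theorem isDiagonalSet_preimage [PathConnectedSpace X] {Y : Type*} [TopologicalSpace Y]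
    {d : C(X × X, Y)} {e : Y}
    (hd : (d.comp ((ContinuousMap.id X).prodMk (ContinuousMap.id X))).Homotopic
      (ContinuousMap.const X e))
    (hd' : ∀ p : Path.Homotopic.Quotient x₀ x₀,
      p.map (d.comp ((ContinuousMap.const X x₀).prodMk (ContinuousMap.id X))) =
        Path.Homotopic.Quotient.refl (d (x₀, x₀)) → p = Path.Homotopic.Quotient.refl x₀)
    {V : Set Y} (hV : LoopsTrivialIn V) : IsDiagonalSet x₀ (d ⁻¹' V) := by
  rw [isDiagonalSet_iff]
  intro u
  refine ⟨PathConnectedSpace.somePath _ _, fun p => ?_⟩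
  refine eq_of_map_prod_eq_refl hd hd' ?_
  refine (congrArg (fun q => Path.Homotopic.Quotient.map q d)
    (Path.Homotopic.prod_projLeft_projRight _)).trans ?_
  let dV : C(d ⁻¹' V, V) := ⟨fun u => ⟨d u, u.2⟩, by fun_prop⟩
  have h1 : (coeClass p).map d = Path.Homotopic.Quotient.refl (d u) := by
    refine Eq.trans ?_ (hV (dV u) (p.map dV))
    induction p using Path.Homotopic.Quotient.ind with | mk p =>
    rfl
  rw [quotient_map_conj, h1]
  exact conj_refl _

end DiagonalSets

/-! ### The difference map and the equality of the two invariants -/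

/-- A connected CW complex that is an H-space has a difference map. -/
theorem exists_difference {X : Type*} [TopologicalSpace X] [T2Space X]
    [Topology.CWComplex (Set.univ : Set X)] [PathConnectedSpace X] [HSpace X] (x₀ : X) :
    ∃ d : C(X × X, X), (d.comp ((ContinuousMap.id X).prodMk (ContinuousMap.id X))).Homotopic
        (ContinuousMap.const X HSpace.e) ∧
      (d.comp ((ContinuousMap.const X x₀).prodMk (ContinuousMap.id X))).Homotopic
        (ContinuousMap.id X) := by
  obtain ⟨j, hj⟩ := exists_leftInverse (X := X)
  refine ⟨HSpace.hmul.comp ((j.comp ContinuousMap.fst).prodMk ContinuousMap.snd), hj, ?_⟩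
  have h1 : (ContinuousMap.const X (j x₀)).Homotopic (ContinuousMap.const X (HSpace.e : X)) :=
    have : Nonempty X := ⟨x₀⟩
    ContinuousMap.homotopic_const_iff.2 (PathConnectedSpace.joined _ _)
  have h2 : (HSpace.hmul.comp ((ContinuousMap.const X (HSpace.e : X)).prodMk
      (ContinuousMap.id X))).Homotopic (ContinuousMap.id X) := ⟨HSpace.eHmul.toHomotopy⟩
  exact ((ContinuousMap.Homotopic.refl HSpace.hmul).comp
    (h1.prodMk (ContinuousMap.Homotopic.refl (ContinuousMap.id X)))).trans h2

end DTopologicalComplexity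

theorem mainTheorem5 {X : Type*} [TopologicalSpace X] [T2Space X]
    [Topology.CWComplex (Set.univ : Set X)] [ConnectedSpace X] [HSpace X] (x₀ : X) :
    DTopologicalComplexity.tcD x₀ = DTopologicalComplexity.catOne x₀ := by
  have hloc : LocallyPathConnectedSpace X :=
    DTopologicalComplexity.locallyPathConnectedSpace_of_CWComplex
  have hpath : PathConnectedSpace X := PathConnectedSpace.of_locallyPathConnectedSpace
  unfold DTopologicalComplexity.tcD DTopologicalComplexity.catOne DTopologicalComplexity.secat
  refine iInf_congr fun k => iInf_congr_Prop ⟨?_, ?_⟩ fun _ => rfl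
  · rintro ⟨U, hU, hcov, hdiag⟩
    have hV : ∀ i, IsOpen {x | (x, x₀) ∈ U i} := fun i =>
      (hU i).preimage (by fun_prop : Continuous fun x : X => (x, x₀))
    refine ⟨fun i => {x | (x, x₀) ∈ U i}, hV, Set.eq_univ_of_forall fun x => ?_, fun i =>
      DTopologicalComplexity.exists_section_of_loopsTrivialIn (hV i)
        ((hdiag i).loopsTrivialIn_slice x₀)⟩
    have : (x, x₀) ∈ ⋃ i, U i := hcov ▸ Set.mem_univ _
    obtain ⟨i, hi⟩ := Set.mem_iUnion.1 this
    exact Set.mem_iUnion.2 ⟨i, hi⟩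
  · rintro ⟨V, hV, hcov, hsec⟩
    obtain ⟨d, hd, hd'⟩ := DTopologicalComplexity.exists_difference x₀
    refine ⟨fun i => d ⁻¹' V i, fun i => (hV i).preimage d.continuous, ?_, fun i => ?_⟩
    · rw [← Set.preimage_iUnion, hcov, Set.preimage_univ]
    · obtain ⟨s, hs⟩ := hsec i
      refine DTopologicalComplexity.isDiagonalSet_preimage hd (fun p hp => ?_)
        (DTopologicalComplexity.loopsTrivialIn_of_section s hs)
      -- The homotopy from `d (x₀, -)` to the identity is free, which is enough, since triviality of
      -- a class is unaffected by conjugation.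
      have := DTopologicalComplexity.quotient_map_eq_refl_of_homotopic hd' hp
      rwa [DTopologicalComplexity.quotient_map_id] at this
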